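/- **Setting.** Fix a finite set of labels. A decorated rooted forest is a finite rooted forest in which each non-root vertex carries a label (labels may repeat); forests are taken up to isomorphism preserving roots, parents and labels. The decorated Connes–Kreimer algebra $\mathcal H$ is the real vector space with basis these forests, graded by the number of vertices, with product the disjoint union $\amalg$ and coproduct $\Delta(x)=\sum_U x|_U\otimes x|_{V(x)\setminus U}$, where $U$ runs over the sets of vertices of $x$ closed under taking children and a vertex that loses its parent becomes an unlabelled root. Let $\bullet$ be the one-vertex forest. For a weak composition $D=(d_1,\dots,d_l)$ of $n$ let $\Delta_D$ be the component of the iterated coproduct in $\mathcal H_{d_1}\otimes\dots\otimes\mathcal H_{d_l}$, let $m$ be the multiplication of tensor factors, and put $$\mathrm{T2R}_n=\tfrac1n\,m\Delta_{1,n-1},\qquad \mathrm{BinT2R}_n(q_2)=\sum_{r=0}^n\tfrac1{r!}(1-q_2)^r q_2^{\,n-r}\,m\Delta_{1^r,n-r}.$$ Let $\eta(x)$ be the sum of the coefficients of $\Delta_{1,\dots,1}(x)$. The chain driven by an operator $\mathbf T$ on the forests with $n$ vertices has transition probabilities $\hat K(x,y)=\frac{\eta(y)}{\eta(x)}\cdot(\text{coefficient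 of }y\text{ in }\mathbf T(x))$. **Employee-firing chains.** Let $T_0$ be a decorated rooted tree on $n_0$ vertices, whose vertices are the positions in a company. A rooted subtree of $T_0$ is a connected set of vertices containing the root; these are the states of the chains (the sets of filled positions). When an employee is fired, a cascade of promotions follows: someone chosen uniformly among those further down from the fired employee is promoted to his position; if there is anybody further down from the position thus vacated, one of those is chosen uniformly and promoted to it, and so on, until a leaf position is vacated. Different firings cause independent cascades. No firing occurs when only one employee (the boss) remains. - *Single model*: if $n$ employees are left, then with probability $n/n_0$ one uniformly chosen employee is fired, and with probability $(n_0-n)/n_0$ nothing changes. - *Binomial model* with parameter $q_2\in[0,1]$: each employee left (including the boss) independently has a performance uniform on $[0,1]$; all those with performance below $1-q_2$ are fired one by one in a uniformly random order. **Theorem.** The chains driven by $\mathrm{T2R}_{n_0}$ and $\mathrm{BinT2R}_{n_0}(q_2)$, $0\le q_2\le1$, started from $T_0$, remain in the set of states $$\{\bullet^{n_0-n}\amalg T \mid T\text{ is a rooted subtree of }T_0\text{ on }n\text{ vertices}\}.$$ For rooted subtrees $T,T'$ of $T_0$ on $n,n'$ vertices, $\bullet^{n_0-n}\amalg T=\bullet^{n_0-n'}\amalg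 T'$ if and only if $T\cong T'$ as decorated trees, and under the identification $\bullet^{n_0-n}\amalg T\mapsto T$ the two chains are the single model and the binomial model, respectively: for every rooted subtree $T$ and every forest $y$ on $n_0$ vertices, $\hat K(\bullet^{n_0-n}\amalg T,\,y)$ is the probability that the model moves in one step from $T$ to some rooted subtree $T'$ with $\bullet^{n_0-n'}\amalg T'=y$. In particular, if the labels of $T_0$ are pairwise distinct, then $\hat K(\bullet^{n_0-n}\amalg T,\bullet^{n_0-n'}\amalg T')$ is the probability of moving from the vertex set $T$ to the vertex set $T'$. Moreover, in the single model, as long as at least two employees are left, choosing the fired employee uniformly from all employees or only from the non-boss employees gives the same transition probabilities. -/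

import Mathlib

noncomputable section

namespace CKTree

/-! ### Decorated rooted forests -/

/-- A decorated rooted forest on the vertex set `V` with labels in `L`. `up v = none` says that
`v` is a root (roots carry no label), `up v = some (w, l)` says that `v` is a child of `w` and has
the label `l`. Well-foundedness of the parent relation excludes cycles (on a finite `V`). -/
structure DForest (L : Type*) (V : Type*) where
  up : V → Option (V × L)
  wf : WellFounded fun w v : V => ∃ l, up v = some (w, l)

namespace DForest

variable {L V W X Y : Type*}

/-- `w` is the parent of `v`. -/
def IsParent (F : DForest L V) (w v : V) : Prop := ∃ l, F.up v = some (w, l)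

/-- `u` lies strictly below `v`, i.e. is a child, a grandchild, ... of `v`. -/
def Below (F : DForest L V) (u v : V) : Prop := Relation.TransGen F.IsParent v u

/-- Isomorphism of decorated rooted forests: a bijection of the vertices that preserves roots,
parents and labels. -/
def Iso (F : DForest L V) (G : DForest L W) : Prop :=
  ∃ e : V ≃ W, ∀ v, G.up (e v) = (F.up v).map (Prod.map e id)

theorem Iso.refl (F : DForest L V) : F.Iso F := ⟨Equiv.refl V, fun v => by simp⟩

theorem Iso.symm {F : DForest L V} {G : DForest L W} : F.Iso G → G.Iso F := by
  rintro ⟨e, he⟩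
  refine ⟨e.symm, fun w => ?_⟩
  have h := he (e.symm w)
  rw [Equiv.apply_symm_apply] at h
  rw [h, Option.map_map]
  have : (Prod.map e.symm id ∘ Prod.map e id : V × L → V × L) = id := by
    ext x <;> simp
  rw [this]; simp

theorem Iso.trans {F : DForest L V} {G : DForest L W} {H : DForest L X} :
    F.Iso G → G.Iso H → F.Iso H := by
  rintro ⟨e, he⟩ ⟨f, hf⟩
  refine ⟨e.trans f, fun v => ?_⟩
  rw [Equiv.trans_apply, hf, he, Option.map_map]
  rfl

/-- The copy of a forest along a bijection of the vertex set. -/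
def transport (F : DForest L V) (e : V ≃ W) : DForest L W where
  up w := (F.up (e.symm w)).map (Prod.map e id)
  wf := by
    refine Subrelation.wf ?_ (InvImage.wf e.symm F.wf)
    rintro a b ⟨l, h⟩
    rw [Option.map_eq_some_iff] at h
    obtain ⟨⟨c, l'⟩, hc, hc'⟩ := h
    simp only [Prod.map_apply, id, Prod.mk.injEq] at hc'
    refine ⟨l', ?_⟩
    rw [hc, ← hc'.1, Equiv.symm_apply_apply]

theorem iso_transport (F : DForest L V) (e : V ≃ W) : F.Iso (F.transport e) :=
  ⟨e, fun v => by simp [transport]⟩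

open Classical in
/-- The forest induced on a set `s` of vertices; a vertex whose parent is not in `s` becomes a
root, and so loses its label. -/
def restrict (F : DForest L V) (s : Finset V) : DForest L {v // v ∈ s} where
  up v := (F.up v).bind fun p => if h : p.1 ∈ s then some (⟨p.1, h⟩, p.2) else none
  wf := by
    refine Subrelation.wf ?_ (InvImage.wf Subtype.val F.wf)
    rintro a b ⟨l, h⟩
    rw [Option.bind_eq_some_iff] at h
    obtain ⟨⟨c, l'⟩, hc, hc'⟩ := h
    split_ifs at hc' with hs
    refine ⟨l', ?_⟩
    simp only [Option.some.injEq, Prod.mk.injEq] at hc'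
    rw [hc, ← hc'.1]

/-- The disjoint union of two forests. -/
def sum (F : DForest L V) (G : DForest L W) : DForest L (V ⊕ W) where
  up := Sum.elim (fun v => (F.up v).map (Prod.map Sum.inl id))
    (fun w => (G.up w).map (Prod.map Sum.inr id))
  wf := by
    have hl : ∀ v : V, Acc (fun a b : V ⊕ W => ∃ l, Sum.elim
        (fun v => (F.up v).map (Prod.map Sum.inl id))
        (fun w => (G.up w).map (Prod.map Sum.inr id)) b = some (a, l)) (Sum.inl v) := by
      intro v
      induction v using F.wf.induction with
      | _ v ih =>
        refine Acc.intro _ ?_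
        rintro a ⟨l, h⟩
        rw [Sum.elim_inl, Option.map_eq_some_iff] at h
        obtain ⟨⟨c, l'⟩, hc, hc'⟩ := h
        simp only [Prod.map_apply, id, Prod.mk.injEq] at hc'
        rw [← hc'.1]
        exact ih c ⟨l', hc⟩
    have hr : ∀ v : W, Acc (fun a b : V ⊕ W => ∃ l, Sum.elim
        (fun v => (F.up v).map (Prod.map Sum.inl id))
        (fun w => (G.up w).map (Prod.map Sum.inr id)) b = some (a, l)) (Sum.inr v) := by
      intro v
      induction v using G.wf.induction with
      | _ v ih =>
        refine Acc.intro _ ?_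
        rintro a ⟨l, h⟩
        rw [Sum.elim_inr, Option.map_eq_some_iff] at h
        obtain ⟨⟨c, l'⟩, hc, hc'⟩ := h
        simp only [Prod.map_apply, id, Prod.mk.injEq] at hc'
        rw [← hc'.1]
        exact ih c ⟨l', hc⟩
    exact ⟨fun x => x.casesOn hl hr⟩

/-- The forest all of whose vertices are roots. -/
def discrete (L V : Type*) : DForest L V where
  up _ := none
  wf := ⟨fun v => Acc.intro v (by rintro w ⟨l, h⟩; simp at h)⟩

theorem Iso.sum {F : DForest L V} {G : DForest L W} {F' : DForest L X} {G' : DForest L Y} :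
    F.Iso F' → G.Iso G' → (F.sum G).Iso (F'.sum G') := by
  rintro ⟨e, he⟩ ⟨f, hf⟩
  refine ⟨Equiv.sumCongr e f, ?_⟩
  rintro (v | w)
  · simp [DForest.sum, he]; rfl
  · simp [DForest.sum, hf]; rfl

end DForest

/-- The isomorphism relation on forests with vertex set `{0, …, n - 1}`. -/
instance forestSetoid (L : Type*) : Setoid (Σ n : ℕ, DForest L (Fin n)) where
  r F G := F.2.Iso G.2
  iseqv := ⟨fun F => DForest.Iso.refl F.2, DForest.Iso.symm, DForest.Iso.trans⟩

/-- The decorated rooted forests, up to isomorphism. -/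
def ForestClass (L : Type*) : Type _ := Quotient (forestSetoid L)

namespace DForest

variable {L V W X : Type*} [Fintype V] [Fintype W] [Fintype X]

/-- The isomorphism class of a forest on any finite vertex set. -/
def toClass (F : DForest L V) : ForestClass L :=
  Quotient.mk (forestSetoid L) ⟨Fintype.card V, F.transport (Fintype.equivFin V)⟩

theorem toClass_eq_iff {F : DForest L V} {G : DForest L W} : F.toClass = G.toClass ↔ F.Iso G := by
  unfold toClass
  refine Quotient.eq.trans ⟨fun h => ?_, fun h => ?_⟩
  · exact (F.iso_transport _).trans (Iso.trans h (G.iso_transport _).symm)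
  · exact Iso.trans (F.iso_transport _).symm (h.trans (G.iso_transport _))

theorem mk_eq_toClass (F : Σ n : ℕ, DForest L (Fin n)) :
    Quotient.mk (forestSetoid L) F = F.2.toClass :=
  Quotient.sound (F.2.iso_transport _)

end DForest

namespace ForestClass

variable {L : Type*}

theorem ind {p : ForestClass L → Prop} (h : ∀ (n : ℕ) (F : DForest L (Fin n)), p F.toClass)
    (x : ForestClass L) : p x := by
  induction x using Quotient.inductionOn with
  | _ F => rw [DForest.mk_eq_toClass]; exact h F.1 F.2

/-- The degree of a forest: its number of vertices. -/
def degree (x : ForestClass L) : ℕ :=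
  Quotient.lift (fun F : Σ n : ℕ, DForest L (Fin n) => F.1) (by
    rintro ⟨m, F⟩ ⟨n, G⟩ ⟨e, -⟩
    simpa using Fintype.card_congr e) x

theorem degree_toClass {V : Type*} [Fintype V] (F : DForest L V) :
    F.toClass.degree = Fintype.card V := rfl

/-- The product of two forests is their disjoint union. -/
instance : Mul (ForestClass L) where
  mul := Quotient.map₂
    (fun F G => ⟨Fintype.card (Fin F.1 ⊕ Fin G.1), (F.2.sum G.2).transport (Fintype.equivFin _)⟩)
    (fun _ _ h _ _ k => (DForest.iso_transport _ _).symm.trans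
      ((DForest.Iso.sum h k).trans (DForest.iso_transport _ _)))

/-- The empty forest. -/
instance : One (ForestClass L) := ⟨(DForest.discrete L (Fin 0)).toClass⟩

theorem toClass_mul_toClass {V W : Type*} [Fintype V] [Fintype W] (F : DForest L V)
    (G : DForest L W) : F.toClass * G.toClass = (F.sum G).toClass :=
  Quotient.sound ((DForest.iso_transport _ _).symm.trans
    ((DForest.Iso.sum (DForest.iso_transport _ _).symm (DForest.iso_transport _ _).symm).trans
      (DForest.iso_transport _ _)))

instance : CommMonoid (ForestClass L) where
  mul_assoc x y z := by
    induction x using ForestClass.ind with | _ a F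
    induction y using ForestClass.ind with | _ b G
    induction z using ForestClass.ind with | _ c H
    rw [toClass_mul_toClass, toClass_mul_toClass, toClass_mul_toClass, toClass_mul_toClass,
      DForest.toClass_eq_iff]
    refine ⟨Equiv.sumAssoc _ _ _, ?_⟩
    rintro ((v | v) | v)
    · simp [DForest.sum]; rfl
    · simp [DForest.sum]; rfl
    · simp [DForest.sum]; rfl
  mul_comm x y := by
    induction x using ForestClass.ind with | _ a F
    induction y using ForestClass.ind with | _ b G
    rw [toClass_mul_toClass, toClass_mul_toClass, DForest.toClass_eq_iff]
    refine ⟨Equiv.sumComm _ _, ?_⟩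
    rintro (v | v)
    · simp [DForest.sum]; rfl
    · simp [DForest.sum]; rfl
  one_mul x := by
    induction x using ForestClass.ind with | _ a F
    change (DForest.discrete L (Fin 0)).toClass * _ = _
    rw [toClass_mul_toClass, DForest.toClass_eq_iff]
    refine ⟨Equiv.emptySum _ _, ?_⟩
    rintro (v | v)
    · exact v.elim0
    · have h : (Prod.map (Equiv.emptySum (Fin 0) (Fin a)) id ∘ Prod.map Sum.inr id :
          Fin a × L → Fin a × L) = id := by ext x <;> simp
      simp [DForest.sum, h]
  mul_one x := by
    induction x using ForestClass.ind with | _ a F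
    change _ * (DForest.discrete L (Fin 0)).toClass = _
    rw [toClass_mul_toClass, DForest.toClass_eq_iff]
    refine ⟨Equiv.sumEmpty _ _, ?_⟩
    rintro (v | v)
    · have h : (Prod.map (Equiv.sumEmpty (Fin a) (Fin 0)) id ∘ Prod.map Sum.inl id :
          Fin a × L → Fin a × L) = id := by ext x <;> simp
      simp [DForest.sum, h]
    · exact v.elim0

/-- The forest with one vertex. -/
def bullet (L : Type*) : ForestClass L := (DForest.discrete L (Fin 1)).toClass

theorem degree_mul (x y : ForestClass L) : (x * y).degree = x.degree + y.degree := by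
  induction x using ForestClass.ind with | _ a F
  induction y using ForestClass.ind with | _ b G
  rw [toClass_mul_toClass, degree_toClass, degree_toClass, degree_toClass, Fintype.card_sum]

theorem degree_bullet_pow (k : ℕ) : (bullet L ^ k).degree = k := by
  induction k with
  | zero => rfl
  | succ k ih => rw [pow_succ, degree_mul, ih]; rfl

end ForestClass

/-- The forests with `n` vertices. -/
abbrev Basis (L : Type*) (n : ℕ) : Type _ := {x : ForestClass L // x.degree = n}

instance (L : Type*) [Finite L] (n : ℕ) : Finite (Basis L n) := by
  have h : Finite (DForest L (Fin n)) :=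
    Finite.of_injective DForest.up (by rintro ⟨u, _⟩ ⟨u', _⟩ h; simpa using h)
  refine Finite.of_surjective
    (fun F : DForest L (Fin n) => (⟨F.toClass, by simp [ForestClass.degree_toClass]⟩ : Basis L n)) ?_
  rintro ⟨x, hx⟩
  induction x using ForestClass.ind with | _ a F
  rw [ForestClass.degree_toClass, Fintype.card_fin] at hx
  subst hx
  exact ⟨F, rfl⟩

instance (L : Type*) [Finite L] (n : ℕ) : Fintype (Basis L n) := Fintype.ofFinite _

instance (L : Type*) (n : ℕ) : DecidableEq (Basis L n) := Classical.decEq _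

/-! ### The decorated Connes–Kreimer algebra -/

open TensorProduct

/-- The decorated Connes–Kreimer algebra: the real vector space with basis the decorated rooted
forests; the product is the bilinear extension of disjoint union. -/
abbrev CK (L : Type*) : Type _ := MonoidAlgebra ℝ (ForestClass L)

section Hopf

variable {L : Type*}

/-- The basis element of a forest. -/
def basisVec (x : ForestClass L) : CK L := MonoidAlgebra.single x 1

/-- Linear extension from the basis of forests. -/
def linExt {M : Type*} [AddCommMonoid M] [Module ℝ M] (f : ForestClass L → M) : CK L →ₗ[ℝ] M :=
  (MonoidAlgebra.basis (ForestClass L) ℝ).constr ℝ f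

open Classical in
/-- The coproduct of a forest: the sum over the admissible cuts, i.e. over the sets `U` of vertices
that contain with a vertex all its children, of (the pruned part `U`) ⊗ (the remaining trunk). -/
def forestCoproduct {V : Type*} [Fintype V] (F : DForest L V) : CK L ⊗[ℝ] CK L :=
  ∑ U : Finset V with ∀ w v, F.IsParent w v → w ∈ U → v ∈ U,
    basisVec (F.restrict U).toClass ⊗ₜ[ℝ] basisVec (F.restrict Uᶜ).toClass

theorem forestCoproduct_congr {V W : Type*} [Fintype V] [Fintype W] {F : DForest L V}
    {G : DForest L W} (h : F.Iso G) : forestCoproduct F = forestCoproduct G := by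
  classical
  obtain ⟨e, he⟩ := h
  have hpar : ∀ w v, G.IsParent (e w) (e v) ↔ F.IsParent w v := by
    intro w v
    unfold DForest.IsParent
    simp [he]
  have hres : ∀ (U : Finset V) (U' : Finset W), (∀ v, e v ∈ U' ↔ v ∈ U) →
      (F.restrict U).toClass = (G.restrict U').toClass := by
    intro U U' hU
    rw [DForest.toClass_eq_iff]
    refine ⟨e.subtypeEquiv fun v => (hU v).symm, fun v => ?_⟩
    simp only [DForest.restrict, Equiv.subtypeEquiv_apply, he]
    rcases F.up v with _ | ⟨c, l⟩
    · rfl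
    · by_cases hc : c ∈ U
      · simp [hc, (hU c).2 hc]
      · simp [hc, (hU c).not.2 hc]
  unfold forestCoproduct
  refine Finset.sum_equiv e.finsetCongr ?_ ?_
  · intro U
    simp only [Finset.mem_filter, Finset.mem_univ, true_and, Equiv.finsetCongr_apply]
    constructor
    · intro h w v hwv hw
      obtain ⟨w, rfl⟩ := e.surjective w
      obtain ⟨v, rfl⟩ := e.surjective v
      simp only [Finset.mem_map_equiv, Equiv.symm_apply_apply] at hw ⊢
      exact h w v ((hpar w v).1 hwv) hw
    · intro h w v hwv hw
      have := h (e w) (e v) ((hpar w v).2 hwv) (by simpa using hw)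
      simpa using this
  · intro U _
    rw [hres U (e.finsetCongr U) (by simp), hres Uᶜ (e.finsetCongr U)ᶜ (by simp)]

/-- The coproduct `Δ`. -/
def coproduct (L : Type*) : CK L →ₗ[ℝ] CK L ⊗[ℝ] CK L :=
  linExt (Quotient.lift (fun F : Σ n : ℕ, DForest L (Fin n) => forestCoproduct F.2)
    fun _ _ h => forestCoproduct_congr h)

open Classical in
/-- The counit. -/
def counit (L : Type*) : CK L →ₗ[ℝ] ℝ := linExt fun x => if x = 1 then 1 else 0

/-- The projection onto the homogeneous component of degree `d`. -/
def proj (L : Type*) (d : ℕ) : CK L →ₗ[ℝ] CK L :=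
  linExt fun x => if x.degree = d then basisVec x else 0

/-- The refined coproduct `Δ_D` for a weak composition `D = (d₁, …, d_l)`: the iterated coproduct
followed by the projection to the component of degrees `d₁, …, d_l`, with values in the `l`-th
tensor power of the algebra, seen inside the tensor algebra. -/
def refinedCoproduct (L : Type*) : List ℕ → CK L →ₗ[ℝ] TensorAlgebra ℝ (CK L)
  | [] => Algebra.linearMap ℝ (TensorAlgebra ℝ (CK L)) ∘ₗ counit L
  | d :: D => LinearMap.mul' ℝ (TensorAlgebra ℝ (CK L)) ∘ₗ
      TensorProduct.map (TensorAlgebra.ι ℝ ∘ₗ proj L d) (refinedCoproduct L D) ∘ₗ coproduct L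

/-- The multiplication of arbitrarily many tensor factors. -/
def multiProduct (L : Type*) : TensorAlgebra ℝ (CK L) →ₐ[ℝ] CK L :=
  TensorAlgebra.lift ℝ LinearMap.id

/-- The operator `m Δ_D`. -/
def descentOp (L : Type*) (D : List ℕ) : CK L →ₗ[ℝ] CK L :=
  (multiProduct L).toLinearMap ∘ₗ refinedCoproduct L D

/-- On a tensor product of homogeneous elements, the sum of the coefficients in the tensor power
of the basis of forests. -/
def sumCoeff (L : Type*) : TensorAlgebra ℝ (CK L) →ₐ[ℝ] ℝ :=
  TensorAlgebra.lift ℝ (linExt fun _ => 1)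

/-- The rescaling function `η(x)`: the sum of the coefficients of `Δ_{1,…,1}(x)`. -/
def eta (x : ForestClass L) : ℝ :=
  sumCoeff L (refinedCoproduct L (List.replicate x.degree 1) (basisVec x))

/-- The top-to-random operator `(1/n) m Δ_{1,n-1}`. -/
def T2R (L : Type*) (n : ℕ) : CK L →ₗ[ℝ] CK L := (1 / (n : ℝ)) • descentOp L [1, n - 1]

/-- The binomial-top-to-random operator with parameter `q`,
`∑_{r=0}^n (1/r!) (1-q)^r q^(n-r) m Δ_{1^r,n-r}`. -/
def BinT2R (L : Type*) (n : ℕ) (q : ℝ) : CK L →ₗ[ℝ] CK L :=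
  ∑ r ∈ Finset.range (n + 1), (1 / (r.factorial : ℝ) * (1 - q) ^ r * q ^ (n - r)) •
    descentOp L (List.replicate r 1 ++ [n - r])

/-- The transition matrix of the chain on the forests with `n` vertices driven by an operator `T`
(the Doob transform of its matrix by `η`). -/
def drivenChain {n : ℕ} (T : CK L →ₗ[ℝ] CK L) : Matrix (Basis L n) (Basis L n) ℝ :=
  Matrix.of fun x y => eta y.1 / eta x.1 * (T (basisVec x.1)).coeff y.1

end Hopf

/-! ### The employee-firing chains -/

section Firing

variable {L V : Type*} (T : DForest L V)

theorem DForest.not_below_self (v : V) : ¬ T.Below v v := by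
  intro h
  exact (WellFounded.transGen T.wf).irrefl.irrefl v h

/-- The graph that underlies a rooted forest. -/
def DForest.graph : SimpleGraph V where
  Adj v w := T.IsParent v w ∨ T.IsParent w v
  symm := ⟨fun _ _ => Or.symm⟩
  loopless := ⟨fun v h => T.not_below_self v (Relation.TransGen.single (h.elim id id))⟩

/-- A rooted subtree of the tree `T` with the given root: a connected set of vertices that
contains the root. -/
def IsRootedSubtree (root : V) (S : Finset V) : Prop :=
  root ∈ S ∧ (T.graph.induce (S : Set V)).Connected

/-- Who sits where in the company: `pos e` is the position of employee `e`, or `none` if `e` is not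
in the company. The positions are the vertices of the tree; an employee is named after the
position that he holds at the start of the month. -/
abbrev Staffing (V : Type*) : Type _ := V → Option V

variable [Fintype V]

open Classical in
/-- The positions that are filled. -/
def filled (pos : Staffing V) : Finset V := {v | ∃ e, pos e = some v}

open Classical in
/-- The employees, with their positions, who are further down the chain of superiority from the
position `v`. -/
def subordinates (pos : Staffing V) (v : V) : Finset (V × V) :=
  {p | pos p.1 = some p.2 ∧ T.Below p.2 v}

open Classical in
/-- The cascade of promotions when the position `v` is vacant: someone further down from `v` is
chosen uniformly and promoted to `v`; his former position is then vacant and is filled in the same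
way. It ends with a vacant position that nobody is below of. -/
def cascade (pos : Staffing V) (v : V) : PMF (Staffing V) :=
  if h : (subordinates T pos v).Nonempty then
    (PMF.uniformOfFinset _ h).bindOnSupport fun p hp =>
      have : Finset.card {u | T.Below u p.2} < Finset.card {u | T.Below u v} := by
        have hb : T.Below p.2 v := by
          have := (PMF.mem_support_uniformOfFinset_iff h p).1 hp
          simp only [subordinates, Finset.mem_filter] at this
          exact this.2.2
        refine Finset.card_lt_card (Finset.ssubset_iff_of_subset ?_ |>.2 ⟨p.2, ?_, ?_⟩)
        · intro u hu
          simp only [Finset.mem_filter, Finset.mem_univ, true_and] at hu ⊢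
          exact Relation.TransGen.trans hb hu
        · simpa using hb
        · simpa using T.not_below_self p.2
      cascade (Function.update pos p.1 (some v)) p.2
  else PMF.pure pos
termination_by Finset.card {u | T.Below u v}

open Classical in
/-- The employee `e` is fired, which causes a cascade of promotions. No firing occurs when only
one employee (the boss) remains. -/
def fire (pos : Staffing V) (e : V) : PMF (Staffing V) :=
  match pos e with
  | none => PMF.pure pos
  | some v => if 1 < (filled pos).card then cascade T (Function.update pos e none) v
      else PMF.pure pos

/-- The employees in a list are fired one by one. -/
def fireList (pos : Staffing V) : List V → PMF (Staffing V)
  | [] => PMF.pure pos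
  | e :: l => (fire T pos e).bind fun pos' => fireList pos' l

open Classical in
/-- The employees in a set are fired one by one, in a uniformly random order. -/
def fireSet (pos : Staffing V) (F : Finset V) : PMF (Staffing V) :=
  (PMF.uniformOfFinset F.toList.permutations.toFinset
    ⟨F.toList, by simp⟩).bind fun l => fireList T pos l

open Classical in
/-- The company at the start of a month, when the filled positions are those in `S`. -/
def startOfMonth (S : Finset V) : Staffing V := fun e => if e ∈ S then some e else none

/-- The probability that the structure `S` of the company becomes `S'` when one employee, chosen
uniformly from `C`, is fired. -/
def uniformFiring (C S S' : Finset V) : ℝ :=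
  ∑ e ∈ C, 1 / (C.card : ℝ) * ((fire T (startOfMonth S) e).map filled S').toReal

open Classical in
/-- The single model: with probability `n / n₀`, where `n` is the current and `n₀` the initial
number of employees, one uniformly chosen employee is fired; otherwise nothing changes. -/
def singleModel : Matrix (Finset V) (Finset V) ℝ := Matrix.of fun S S' =>
  (S.card : ℝ) / Fintype.card V * uniformFiring T S S S' +
    ((Fintype.card V : ℝ) - S.card) / Fintype.card V * (if S' = S then 1 else 0)

/-- The probability that exactly the employees in `F` (a part of `S`) perform below `1 - q`, when
the performances of the employees in `S` are independent and uniform on `[0, 1]`. -/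
def underperformProb (q : ℝ) (S F : Finset V) : ℝ :=
  (MeasureTheory.Measure.pi fun _ : {e // e ∈ S} =>
    MeasureTheory.volume.restrict (Set.Icc (0 : ℝ) 1)).real
      {perf | ∀ e, perf e < 1 - q ↔ (e : V) ∈ F}

/-- The binomial model: all employees with performance below `1 - q` are fired one by one in a
random order. -/
def binomialModel (q : ℝ) : Matrix (Finset V) (Finset V) ℝ := Matrix.of fun S S' =>
  ∑ F ∈ S.powerset, underperformProb q S F *
    ((fireSet T (startOfMonth S) F).map filled S').toReal

/-- The forest `•^(n₀ - n) ⨿ T[S]` of the structure `S` on `n` of the `n₀` vertices of `T`. -/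
def companyState (S : Finset V) : Basis L (Fintype.card V) :=
  ⟨ForestClass.bullet L ^ (Fintype.card V - S.card) * (T.restrict S).toClass, by
    rw [ForestClass.degree_mul, ForestClass.degree_bullet_pow, ForestClass.degree_toClass,
      Fintype.card_coe]
    exact Nat.sub_add_cancel (Finset.card_le_univ S)⟩

/-- The tree `T` itself, as a state. -/
def initialState : Basis L (Fintype.card V) := ⟨T.toClass, rfl⟩

open Classical in
/-- The total weight, under `μ`, of the rooted subtrees `S'` of `T` whose state
`•^(n₀ - n) ⨿ T[S']` is `y`. (Several vertex sets may carry isomorphic decorated trees, unless the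
labels are distinct.) -/
def weightOfState (root : V) (μ : Finset V → ℝ) (y : Basis L (Fintype.card V)) : ℝ :=
  ∑ S' : Finset V with IsRootedSubtree T root S' ∧ companyState T S' = y, μ S'

end Firing

end CKTree

end

/-
For a forest `x` let `∂ x` be the sum of the forests obtained from `x` by deleting one leaf. Then
`m Δ_{1^r,n-r} = •^r ∂^r` on forests with `n` vertices, and `η(x)` counts the orders in which all
vertices of `x` can be deleted, always a leaf at a time. Moreover `∂` is a derivation with
`∂ • = 1`. Hence, on the states `•^(n₀ - n) ⨿ T`, the Doob transforms of `T2R` and `BinT2R` remove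
random leaves of `T` one after the other, where the leaf `u` of `S` is chosen with probability
`η(S \ {u}) / η(S)`.

On the side of the company, a cascade of promotions is the hook walk of Greene, Nijenhuis and Wilf:
it vacates a random leaf of `S`, and when it starts from a uniformly chosen position, this leaf is
`u` with probability `η(S \ {u}) / η(S)`. In a tree the walk from the root ends with the same
distribution, which is why the boss may be exempted from firing.
-/

noncomputable section

namespace CKTree

open Classical TensorProduct
open ForestClass (bullet)

section LeafDeletion

variable {L V W : Type*} {F : DForest L V} {G : DForest L W} {S : Finset V}

/-! ### The order of a forest -/

namespace DForest

theorem restrict_up_eq_some_iff {v w : {v // v ∈ S}} {l : L} :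
    (F.restrict S).up v = some (w, l) ↔ F.up v = some (w.1, l) := by
  simp only [restrict, Option.bind_eq_some_iff]
  constructor
  · rintro ⟨⟨c, m⟩, hc, h⟩
    split_ifs at h
    simp only [Option.some.injEq, Prod.mk.injEq] at h
    rw [hc, ← h.1, h.2]
  · exact fun h => ⟨_, h, by simp⟩

theorem isParent_restrict_iff {v w : {v // v ∈ S}} :
    (F.restrict S).IsParent v w ↔ F.IsParent v w := by
  simp only [IsParent, restrict_up_eq_some_iff]

theorem Iso.of_up_eq_some_iff (e : V ≃ W)
    (h : ∀ v w l, F.up v = some (w, l) ↔ G.up (e v) = some (e w, l)) : F.Iso G := by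
  refine ⟨e, fun v => Option.ext fun ⟨w, l⟩ => ?_⟩
  obtain ⟨w, rfl⟩ := e.surjective w
  rw [← h, Option.map_eq_some_iff]
  constructor
  · exact fun hv => ⟨_, hv, rfl⟩
  · rintro ⟨⟨a, m⟩, ha, hb⟩
    simp only [Prod.map_apply, id, Prod.mk.injEq, e.injective.eq_iff] at hb
    rw [ha, hb.1, hb.2]

theorem iso_restrict_of_embedding {S : Finset W} (f : V ↪ W)
    (hf : ∀ v w l, F.up v = some (w, l) ↔ G.up (f v) = some (f w, l))
    (hS : ∀ w, w ∈ S ↔ ∃ v, f v = w) : F.Iso (G.restrict S) := by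
  refine Iso.of_up_eq_some_iff (Equiv.ofBijective (fun v => ⟨f v, (hS _).2 ⟨v, rfl⟩⟩) ⟨?_, ?_⟩)
    fun v w l => by rw [restrict_up_eq_some_iff]; exact hf v w l
  · exact fun v w h => f.injective (Subtype.ext_iff.1 h)
  · rintro ⟨w, hw⟩
    obtain ⟨v, rfl⟩ := (hS w).1 hw
    exact ⟨v, rfl⟩

theorem iso_restrict_univ [Fintype V] (F : DForest L V) : F.Iso (F.restrict Finset.univ) :=
  iso_restrict_of_embedding (Function.Embedding.refl V) (fun _ _ _ => Iff.rfl) fun v => by simp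

theorem not_isParent_self (v : V) : ¬ F.IsParent v v := fun h =>
  F.not_below_self v (Relation.TransGen.single h)

theorem IsParent.unique {u v w : V} (hv : F.IsParent v u) (hw : F.IsParent w u) : v = w := by
  obtain ⟨l, hv⟩ := hv
  obtain ⟨m, hw⟩ := hw
  exact congrArg Prod.fst (Option.some_injective _ (hv.symm.trans hw))

theorem IsParent.below {v w : V} (h : F.IsParent w v) : F.Below v w := Relation.TransGen.single h

/-- The reflexive closure of the relation `Below`: `u` is `v` or lies below `v`. -/
def BelowEq (F : DForest L V) (u v : V) : Prop := Relation.ReflTransGen F.IsParent v u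

theorem belowEq_iff {u v : V} : F.BelowEq u v ↔ u = v ∨ F.Below u v :=
  Relation.reflTransGen_iff_eq_or_transGen

theorem BelowEq.refl (v : V) : F.BelowEq v v := Relation.ReflTransGen.refl

theorem BelowEq.trans {u v w : V} (h : F.BelowEq u v) (h' : F.BelowEq v w) : F.BelowEq u w :=
  Relation.ReflTransGen.trans h' h

theorem Below.belowEq {u v : V} (h : F.Below u v) : F.BelowEq u v :=
  Relation.TransGen.to_reflTransGen h

theorem Below.trans_belowEq {u v w : V} (h : F.Below u v) (h' : F.BelowEq v w) : F.Below u w :=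
  Relation.TransGen.trans_right h' h

theorem BelowEq.trans_below {u v w : V} (h : F.BelowEq u v) (h' : F.Below v w) : F.Below u w :=
  Relation.TransGen.trans_left h' h

theorem Below.ne {u v : V} (h : F.Below u v) : u ≠ v := by
  rintro rfl
  exact F.not_below_self _ h

theorem Below.not_belowEq {u v : V} (h : F.Below u v) : ¬ F.BelowEq v u := fun h' =>
  F.not_below_self _ (h.trans_belowEq h')

theorem BelowEq.below_of_ne {u v : V} (h : F.BelowEq u v) (hne : u ≠ v) : F.Below u v :=
  (belowEq_iff.1 h).resolve_left hne

theorem BelowEq.antisymm {u v : V} (h : F.BelowEq u v) (h' : F.BelowEq v u) : u = v := by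
  by_contra hne
  exact (h.below_of_ne hne).not_belowEq h'

theorem BelowEq.total {u v w : V} (hv : F.BelowEq u v) (hw : F.BelowEq u w) :
    F.BelowEq v w ∨ F.BelowEq w v := by
  have hu : Relator.RightUnique (Function.swap F.IsParent) := fun _ _ _ h h' => h.unique h'
  exact (Relation.ReflTransGen.total_of_right_unique hu (Relation.reflTransGen_swap.2 hv)
    (Relation.reflTransGen_swap.2 hw)).imp Relation.reflTransGen_swap.1 Relation.reflTransGen_swap.1

theorem Below.exists_child {u v : V} (h : F.Below u v) : ∃ c, F.IsParent v c ∧ F.BelowEq u c :=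
  Relation.TransGen.head'_iff.1 h

theorem Below.belowEq_parent {u v w : V} (h : F.Below u v) (hw : F.IsParent w u) :
    F.BelowEq w v := by
  obtain ⟨p, hp, hpu⟩ := Relation.TransGen.tail'_iff.1 h
  rwa [hw.unique hpu]

theorem exists_greatest_ancestor (F : DForest L V) (u : V) :
    ∃ r, F.BelowEq u r ∧ ∀ w, F.BelowEq u w → F.BelowEq w r := by
  induction u using F.wf.induction with
  | _ u ih =>
    by_cases hu : ∃ p, F.IsParent p u
    · obtain ⟨p, hp⟩ := hu
      obtain ⟨r, hpr, hr⟩ := ih p hp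
      have hur := (hp.below.trans_belowEq hpr).belowEq
      refine ⟨r, hur, fun w hw => ?_⟩
      obtain rfl | hw := belowEq_iff.1 hw
      · exact hur
      · exact hr w (hw.belowEq_parent hp)
    · refine ⟨u, BelowEq.refl u, fun w hw => ?_⟩
      obtain rfl | hw := belowEq_iff.1 hw
      · exact BelowEq.refl u
      · obtain ⟨p, -, hp⟩ := Relation.TransGen.tail'_iff.1 hw
        exact absurd ⟨p, hp⟩ hu

end DForest

/-- The leaves of the forest induced on `S`, as vertices of the ambient forest. -/
def leaves (F : DForest L V) (S : Finset V) : Finset V := {u ∈ S | ∀ w ∈ S, ¬ F.IsParent u w}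

theorem mem_leaves {u : V} : u ∈ leaves F S ↔ u ∈ S ∧ ∀ w ∈ S, ¬ F.IsParent u w := by
  simp only [leaves, Finset.mem_filter]

theorem mem_of_mem_leaves {u : V} (hu : u ∈ leaves F S) : u ∈ S := (mem_leaves.1 hu).1

theorem card_erase_add_one_of_mem_leaves {u : V} (hu : u ∈ leaves F S) :
    (S.erase u).card + 1 = S.card :=
  Finset.card_erase_add_one (mem_of_mem_leaves hu)

/-- The hook length of `v` in `S`: the number of vertices of `S` that are `v` or below `v`. -/
def hookLength (F : DForest L V) (S : Finset V) (v : V) : ℕ := {u ∈ S | F.BelowEq u v}.card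

theorem hookLength_pos {v : V} (hv : v ∈ S) : 0 < hookLength F S v :=
  Finset.card_pos.2 ⟨v, Finset.mem_filter.2 ⟨hv, DForest.BelowEq.refl v⟩⟩

theorem hookLength_lt {v w : V} (hv : v ∈ S) (h : F.Below w v) :
    hookLength F S w < hookLength F S v := by
  refine Finset.card_lt_card ((Finset.ssubset_iff_of_subset fun u hu => ?_).2 ⟨v, ?_, ?_⟩)
  · rw [Finset.mem_filter] at hu ⊢
    exact ⟨hu.1, hu.2.trans h.belowEq⟩
  · exact Finset.mem_filter.2 ⟨hv, DForest.BelowEq.refl v⟩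
  · exact fun h' => h.not_belowEq (Finset.mem_filter.1 h').2

theorem leaves_nonempty (F : DForest L V) (hS : S.Nonempty) : (leaves F S).Nonempty := by
  obtain ⟨u, hu, hmin⟩ := S.exists_min_image (hookLength F S) hS
  exact ⟨u, mem_leaves.2 ⟨hu, fun w hw h => (hmin w hw).not_gt (hookLength_lt hu h.below)⟩⟩

/-! ### Leaf deletion -/

theorem linExt_basisVec {M : Type*} [AddCommMonoid M] [Module ℝ M] (f : ForestClass L → M)
    (x : ForestClass L) : linExt f (basisVec x) = f x := by
  rw [linExt, basisVec, ← MonoidAlgebra.basis_apply, Module.Basis.constr_basis]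

theorem linearMap_ext_basisVec {M : Type*} [AddCommMonoid M] [Module ℝ M] {f g : CK L →ₗ[ℝ] M}
    (h : ∀ x, f (basisVec x) = g (basisVec x)) : f = g :=
  (MonoidAlgebra.basis (ForestClass L) ℝ).ext fun x => by
    rw [MonoidAlgebra.basis_apply]
    exact h x

theorem basisVec_mul (x y : ForestClass L) : basisVec (x * y) = basisVec x * basisVec y := by
  simp [basisVec, MonoidAlgebra.single_mul_single]

theorem basisVec_pow (x : ForestClass L) (k : ℕ) : basisVec (x ^ k) = basisVec x ^ k :=
  map_pow (MonoidAlgebra.of ℝ (ForestClass L)) x k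

theorem basisVec_injective : Function.Injective (basisVec : ForestClass L → CK L) :=
  MonoidAlgebra.of_injective

theorem coproduct_toClass [Fintype V] (F : DForest L V) :
    coproduct L (basisVec F.toClass) = forestCoproduct F :=
  (linExt_basisVec _ _).trans (forestCoproduct_congr (F.iso_transport _).symm)

theorem proj_basisVec (d : ℕ) (x : ForestClass L) :
    proj L d (basisVec x) = if x.degree = d then basisVec x else 0 := linExt_basisVec _ x

theorem counit_basisVec (x : ForestClass L) :
    counit L (basisVec x) = if x = 1 then 1 else 0 := linExt_basisVec _ x

theorem ForestClass.eq_one_of_degree_eq_zero {x : ForestClass L} (hx : x.degree = 0) : x = 1 := by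
  induction x using ForestClass.ind with | _ n F
  rw [degree_toClass, Fintype.card_fin] at hx
  subst hx
  exact DForest.toClass_eq_iff.2
    (DForest.Iso.of_up_eq_some_iff (Equiv.refl _) fun v => v.elim0)

theorem ForestClass.eq_bullet_of_degree_eq_one {x : ForestClass L} (hx : x.degree = 1) :
    x = bullet L := by
  induction x using ForestClass.ind with | _ n F
  rw [degree_toClass, Fintype.card_fin] at hx
  subst hx
  refine DForest.toClass_eq_iff.2 (DForest.Iso.of_up_eq_some_iff (Equiv.refl _) fun v w l => ?_)
  refine iff_of_false (fun h => ?_) (Option.some_ne_none _).symm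
  obtain rfl := Subsingleton.elim v w
  exact F.not_isParent_self v ⟨l, h⟩

theorem ForestClass.exists_toClass_restrict_univ (x : ForestClass L) :
    ∃ F : DForest L (Fin x.degree), (F.restrict Finset.univ).toClass = x := by
  induction x using ForestClass.ind with | _ n F
  exact ⟨F.transport (Fintype.equivFin _), DForest.toClass_eq_iff.2
    ((F.iso_transport _).trans (DForest.iso_restrict_univ _)).symm⟩

/-- The operator that sends a forest to the sum of the forests with one leaf deleted. It is the
part of the coproduct with a single vertex in the first tensor factor. -/
def leafDeletion (L : Type*) : CK L →ₗ[ℝ] CK L :=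
  (TensorProduct.lid ℝ (CK L)).toLinearMap ∘ₗ
    TensorProduct.map (linExt fun x => if x.degree = 1 then (1 : ℝ) else 0) LinearMap.id ∘ₗ
      coproduct L

theorem leafDeletion_toClass [Fintype V] [DecidableEq V] (F : DForest L V) :
    leafDeletion L (basisVec F.toClass) =
      ∑ v ∈ leaves F Finset.univ, basisVec (F.restrict (Finset.univ.erase v)).toClass := by
  obtain rfl : ‹DecidableEq V› = fun v w => propDecidable (v = w) := Subsingleton.elim _ _
  simp only [leafDeletion, LinearMap.comp_apply, coproduct_toClass, forestCoproduct, map_sum,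
    TensorProduct.map_tmul, linExt_basisVec, LinearMap.id_apply, LinearEquiv.coe_coe,
    TensorProduct.lid_tmul, ForestClass.degree_toClass, Fintype.card_coe, ite_smul, one_smul,
    zero_smul]
  have hcompl : ∀ v, basisVec (F.restrict (Finset.univ.erase v)).toClass =
      basisVec (F.restrict {v}ᶜ).toClass := fun v => by rw [Finset.compl_singleton]
  rw [← Finset.sum_filter, Finset.filter_filter, Finset.sum_congr rfl fun v _ => hcompl v,
    ← Finset.sum_image (f := fun U => basisVec (F.restrict Uᶜ).toClass)
      Finset.singleton_injective.injOn]
  refine Finset.sum_congr (Finset.ext fun U => ?_) fun _ _ => rfl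
  simp only [Finset.mem_filter, Finset.mem_univ, true_and, Finset.mem_image, mem_leaves,
    Finset.card_eq_one]
  constructor
  · rintro ⟨hU, v, rfl⟩
    refine ⟨v, fun w _ hw => F.not_isParent_self v ?_, rfl⟩
    rwa [Finset.mem_singleton.1 (hU v w hw (Finset.mem_singleton_self v))] at hw
  · rintro ⟨v, hv, rfl⟩
    refine ⟨fun w u hwu hw => ?_, v, rfl⟩
    rw [Finset.mem_singleton.1 hw] at hwu
    exact absurd hwu (hv u trivial)

theorem leafDeletion_restrict (F : DForest L V) (S : Finset V) :
    leafDeletion L (basisVec (F.restrict S).toClass) =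
      ∑ u ∈ leaves F S, basisVec (F.restrict (S.erase u)).toClass := by
  rw [leafDeletion_toClass]
  refine Finset.sum_bij (fun v _ => v.1) (fun v hv => ?_) (fun _ _ _ _ => Subtype.ext)
    (fun u hu => ⟨⟨u, mem_of_mem_leaves hu⟩, ?_, rfl⟩) fun v _ => ?_
  · exact mem_leaves.2 ⟨v.2, fun w hw h => (mem_leaves.1 hv).2 ⟨w, hw⟩ (Finset.mem_univ _)
      (DForest.isParent_restrict_iff.2 h)⟩
  · exact mem_leaves.2 ⟨Finset.mem_univ _, fun w _ h =>
      (mem_leaves.1 hu).2 w w.2 (DForest.isParent_restrict_iff.1 h)⟩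
  · refine congrArg basisVec (DForest.toClass_eq_iff.2 ?_)
    refine DForest.iso_restrict_of_embedding
      ((Function.Embedding.subtype _).trans (Function.Embedding.subtype _))
      (fun _ _ _ => ?_) fun w => ?_
    · simp only [DForest.restrict_up_eq_some_iff, Function.Embedding.trans_apply,
        Function.Embedding.subtype_apply]
    · constructor
      · intro hw
        exact ⟨⟨⟨w, Finset.mem_of_mem_erase hw⟩, Finset.mem_erase.2
          ⟨fun h => Finset.ne_of_mem_erase hw (congrArg Subtype.val h), Finset.mem_univ _⟩⟩, rfl⟩
      · rintro ⟨⟨⟨w, hw⟩, hne⟩, rfl⟩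
        exact Finset.mem_erase.2 ⟨fun h => Finset.ne_of_mem_erase hne (Subtype.ext h), hw⟩

theorem iterate_succ_leafDeletion_restrict (F : DForest L V) (S : Finset V) (r : ℕ) :
    (leafDeletion L)^[r + 1] (basisVec (F.restrict S).toClass) =
      ∑ u ∈ leaves F S, (leafDeletion L)^[r] (basisVec (F.restrict (S.erase u)).toClass) := by
  rw [Function.iterate_succ_apply, leafDeletion_restrict, ← Module.End.coe_pow, map_sum]

theorem proj_iterate_leafDeletion_restrict (F : DForest L V) (S : Finset V) (r : ℕ) :
    proj L (S.card - r) ((leafDeletion L)^[r] (basisVec (F.restrict S).toClass)) =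
      (leafDeletion L)^[r] (basisVec (F.restrict S).toClass) := by
  induction r generalizing S with
  | zero => simp [proj_basisVec, ForestClass.degree_toClass]
  | succ r ih =>
    rw [iterate_succ_leafDeletion_restrict, map_sum]
    refine Finset.sum_congr rfl fun u hu => ?_
    rw [← card_erase_add_one_of_mem_leaves hu, Nat.add_sub_add_right, ih]

theorem iterate_leafDeletion_restrict_eq_zero (F : DForest L V) {S : Finset V} {r : ℕ}
    (hr : S.card < r) : (leafDeletion L)^[r] (basisVec (F.restrict S).toClass) = 0 := by
  induction r generalizing S with
  | zero => omega
  | succ r ih =>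
    rw [iterate_succ_leafDeletion_restrict]
    refine Finset.sum_eq_zero fun u hu => ih ?_
    have := card_erase_add_one_of_mem_leaves hu
    omega

theorem iterate_leafDeletion_eq_zero {x : ForestClass L} {r : ℕ} (hr : x.degree < r) :
    (leafDeletion L)^[r] (basisVec x) = 0 := by
  obtain ⟨F, hF⟩ := x.exists_toClass_restrict_univ
  rw [← hF]
  exact iterate_leafDeletion_restrict_eq_zero F (by simpa using hr)

theorem refinedCoproduct_one_cons (D : List ℕ) (z : CK L) :
    refinedCoproduct L (1 :: D) z =
      TensorAlgebra.ι ℝ (basisVec (bullet L)) * refinedCoproduct L D (leafDeletion L z) := by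
  have h : LinearMap.mul' ℝ (TensorAlgebra ℝ (CK L)) ∘ₗ
      TensorProduct.map (TensorAlgebra.ι ℝ ∘ₗ proj L 1) (refinedCoproduct L D) =
      LinearMap.mulLeft ℝ (TensorAlgebra.ι ℝ (basisVec (bullet L))) ∘ₗ
        refinedCoproduct L D ∘ₗ (TensorProduct.lid ℝ (CK L)).toLinearMap ∘ₗ
        TensorProduct.map (linExt fun x => if x.degree = 1 then (1 : ℝ) else 0) LinearMap.id := by
    refine TensorProduct.ext (linearMap_ext_basisVec fun x => LinearMap.ext fun w => ?_)
    simp only [LinearMap.compr₂ₛₗ_apply, TensorProduct.mk_apply, LinearMap.comp_apply,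
      TensorProduct.map_tmul, LinearMap.mul'_apply, proj_basisVec, linExt_basisVec,
      LinearEquiv.coe_coe, TensorProduct.lid_tmul, LinearMap.mulLeft_apply, LinearMap.id_apply]
    split_ifs with hx
    · rw [ForestClass.eq_bullet_of_degree_eq_one hx, one_smul]
    · simp
  exact LinearMap.congr_fun h (coproduct L z)

theorem descentOp_singleton (d : ℕ) : descentOp L [d] = proj L d := by
  refine linearMap_ext_basisVec fun x => ?_
  induction x using ForestClass.ind with | _ n F
  simp only [descentOp, LinearMap.comp_apply, refinedCoproduct, coproduct_toClass, forestCoproduct,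
    map_sum, TensorProduct.map_tmul, LinearMap.mul'_apply, counit_basisVec]
  rw [Finset.sum_eq_single Finset.univ]
  · rw [if_pos (ForestClass.eq_one_of_degree_eq_zero (by simp [ForestClass.degree_toClass])),
      ← DForest.toClass_eq_iff.2 F.iso_restrict_univ]
    simp [multiProduct]
  · intro U _ hU
    rw [if_neg, map_zero, mul_zero, map_zero]
    intro h
    have hdeg := (Fintype.card_coe _).symm.trans (congrArg ForestClass.degree h)
    exact hU ((@Finset.compl_eq_empty_iff _ _ (_) U).1 (Finset.card_eq_zero.1 hdeg))
  · simp

theorem descentOp_replicate_one_append (r : ℕ) (D : List ℕ) (z : CK L) :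
    descentOp L (List.replicate r 1 ++ D) z =
      basisVec (bullet L) ^ r * descentOp L D ((leafDeletion L)^[r] z) := by
  induction r generalizing z with
  | zero => simp
  | succ r ih =>
    have hcons : descentOp L (1 :: (List.replicate r 1 ++ D)) z =
        basisVec (bullet L) * descentOp L (List.replicate r 1 ++ D) (leafDeletion L z) := by
      rw [descentOp, LinearMap.comp_apply, refinedCoproduct_one_cons]
      simp [multiProduct, descentOp]
    rw [List.replicate_succ, List.cons_append, hcons, ih, pow_succ', Function.iterate_succ_apply,
      mul_assoc]

theorem descentOp_replicate_one_append_sub (x : ForestClass L) (r : ℕ) :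
    descentOp L (List.replicate r 1 ++ [x.degree - r]) (basisVec x) =
      basisVec (bullet L) ^ r * (leafDeletion L)^[r] (basisVec x) := by
  obtain ⟨F, hF⟩ := x.exists_toClass_restrict_univ
  have hproj := proj_iterate_leafDeletion_restrict F Finset.univ r
  rw [hF, Finset.card_univ, Fintype.card_fin] at hproj
  rw [descentOp_replicate_one_append, descentOp_singleton, hproj]

theorem eta_eq_counit_iterate_leafDeletion (x : ForestClass L) :
    eta x = counit L ((leafDeletion L)^[x.degree] (basisVec x)) := by
  suffices h : ∀ (r : ℕ) (z : CK L), sumCoeff L (refinedCoproduct L (List.replicate r 1) z) =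
      counit L ((leafDeletion L)^[r] z) from h _ _
  intro r
  induction r with
  | zero => simp [refinedCoproduct, sumCoeff]
  | succ r ih =>
    intro z
    rw [List.replicate_succ, refinedCoproduct_one_cons, map_mul, ih, Function.iterate_succ_apply]
    simp [sumCoeff, linExt_basisVec]

theorem eta_restrict_eq_sum_leaves (F : DForest L V) (hS : S.Nonempty) :
    eta (F.restrict S).toClass = ∑ u ∈ leaves F S, eta (F.restrict (S.erase u)).toClass := by
  obtain ⟨n, hn⟩ := Nat.exists_eq_add_one.2 (Finset.card_pos.2 hS)
  simp only [eta_eq_counit_iterate_leafDeletion, ForestClass.degree_toClass, Fintype.card_coe]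
  rw [hn, iterate_succ_leafDeletion_restrict, map_sum]
  refine Finset.sum_congr rfl fun u hu => ?_
  rw [show (S.erase u).card = n by have := card_erase_add_one_of_mem_leaves hu; omega]

theorem eta_restrict_empty (F : DForest L V) : eta (F.restrict ∅).toClass = 1 := by
  rw [ForestClass.eq_one_of_degree_eq_zero (x := (F.restrict ∅).toClass)
      (by simp [ForestClass.degree_toClass]),
    eta_eq_counit_iterate_leafDeletion]
  exact (counit_basisVec 1).trans (if_pos rfl)

theorem eta_restrict_pos (F : DForest L V) (S : Finset V) : 0 < eta (F.restrict S).toClass := by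
  induction S using Finset.strongInduction with
  | _ S ih =>
    obtain rfl | hS := S.eq_empty_or_nonempty
    · rw [eta_restrict_empty]
      exact one_pos
    · rw [eta_restrict_eq_sum_leaves F hS]
      exact Finset.sum_pos (fun u hu => ih _ (Finset.erase_ssubset (mem_of_mem_leaves hu)))
        (leaves_nonempty F hS)

/-! ### Isolated vertices -/

namespace DForest

theorem sum_up_inl_eq_some_inl {v w : V} {l : L} :
    (F.sum G).up (Sum.inl v) = some (Sum.inl w, l) ↔ F.up v = some (w, l) := by
  simp [sum, Option.map_eq_some_iff]

theorem sum_up_inr_eq_some_inr {v w : W} {l : L} :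
    (F.sum G).up (Sum.inr v) = some (Sum.inr w, l) ↔ G.up v = some (w, l) := by
  simp [sum, Option.map_eq_some_iff]

theorem sum_up_inl_ne_some_inr {v : V} {w : W} {l : L} :
    (F.sum G).up (Sum.inl v) ≠ some (Sum.inr w, l) := by
  simp [sum, Option.map_eq_some_iff]

theorem sum_up_inr_ne_some_inl {v : W} {w : V} {l : L} :
    (F.sum G).up (Sum.inr v) ≠ some (Sum.inl w, l) := by
  simp [sum, Option.map_eq_some_iff]

end DForest

theorem leaves_sum_univ [Fintype V] [Fintype W] (F : DForest L V) (G : DForest L W) :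
    leaves (F.sum G) Finset.univ = (leaves F Finset.univ).disjSum (leaves G Finset.univ) := by
  ext (v | w) <;>
  simp [mem_leaves, DForest.IsParent, DForest.sum_up_inl_eq_some_inl,
    DForest.sum_up_inr_eq_some_inr, DForest.sum_up_inl_ne_some_inr, DForest.sum_up_inr_ne_some_inl]

theorem DForest.toClass_restrict_sum {A : Finset V} {B : Finset W} {C : Finset (V ⊕ W)}
    (hA : ∀ v, Sum.inl v ∈ C ↔ v ∈ A) (hB : ∀ w, Sum.inr w ∈ C ↔ w ∈ B) :
    ((F.sum G).restrict C).toClass = (F.restrict A).toClass * (G.restrict B).toClass := by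
  rw [ForestClass.toClass_mul_toClass, toClass_eq_iff]
  refine (iso_restrict_of_embedding
    ((Function.Embedding.subtype _).sumMap (Function.Embedding.subtype _)) ?_ ?_).symm
  · rintro (v | v) (w | w) l <;>
    simp [sum_up_inl_eq_some_inl, sum_up_inr_eq_some_inr, sum_up_inl_ne_some_inr,
      sum_up_inr_ne_some_inl, restrict_up_eq_some_iff]
  · rintro (v | w) <;> simp [hA, hB]

theorem leafDeletion_mul (y z : CK L) :
    leafDeletion L (y * z) = leafDeletion L y * z + y * leafDeletion L z := by
  suffices h : (LinearMap.mul ℝ (CK L)).compr₂ (leafDeletion L) =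
      LinearMap.mul ℝ (CK L) ∘ₗ leafDeletion L + (LinearMap.mul ℝ (CK L)).compl₂ (leafDeletion L)
    from LinearMap.congr_fun₂ h y z
  refine linearMap_ext_basisVec fun x => linearMap_ext_basisVec fun y => ?_
  induction x using ForestClass.ind with | _ m F
  induction y using ForestClass.ind with | _ n G
  simp only [LinearMap.compr₂_apply, LinearMap.mul_apply', LinearMap.add_apply,
    LinearMap.comp_apply, LinearMap.compl₂_apply, ← basisVec_mul, ForestClass.toClass_mul_toClass]
  rw [leafDeletion_toClass, leaves_sum_univ, Finset.sum_disjSum, leafDeletion_toClass,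
    leafDeletion_toClass, Finset.sum_mul, Finset.mul_sum]
  congr 1 <;> refine Finset.sum_congr rfl fun v _ => ?_
  · rw [← basisVec_mul, DForest.toClass_eq_iff.2 G.iso_restrict_univ]
    exact congrArg basisVec (DForest.toClass_restrict_sum (by simp) (by simp))
  · rw [← basisVec_mul, DForest.toClass_eq_iff.2 F.iso_restrict_univ]
    exact congrArg basisVec (DForest.toClass_restrict_sum (by simp) (by simp))

theorem leafDeletion_bullet : leafDeletion L (basisVec (bullet L)) = 1 := by
  have hroots : leaves (DForest.discrete L (Fin 1)) Finset.univ = {0} := by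
    ext v
    simp [mem_leaves, DForest.IsParent, DForest.discrete, Subsingleton.elim v 0]
  rw [bullet, leafDeletion_toClass, hroots, Finset.sum_singleton,
    ForestClass.eq_one_of_degree_eq_zero (x := DForest.toClass _)
      (by simp [ForestClass.degree_toClass])]
  rfl

theorem iterate_succ_leafDeletion_bullet_mul (r : ℕ) (z : CK L) :
    (leafDeletion L)^[r + 1] (basisVec (bullet L) * z) =
      (r + 1 : ℝ) • (leafDeletion L)^[r] z + basisVec (bullet L) * (leafDeletion L)^[r + 1] z := by
  induction r with
  | zero => simp [leafDeletion_mul, leafDeletion_bullet]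
  | succ r ih =>
    rw [Function.iterate_succ_apply', ih, map_add, map_smul, leafDeletion_mul, leafDeletion_bullet,
      ← Function.iterate_succ_apply' (leafDeletion L),
      ← Function.iterate_succ_apply' (leafDeletion L), one_mul]
    push_cast
    module

theorem eta_bullet_mul (x : ForestClass L) : eta (bullet L * x) = (x.degree + 1) * eta x := by
  have hdeg : (bullet L * x).degree = x.degree + 1 := by
    rw [ForestClass.degree_mul, add_comm]
    rfl
  rw [eta_eq_counit_iterate_leafDeletion, eta_eq_counit_iterate_leafDeletion, hdeg, basisVec_mul,
    iterate_succ_leafDeletion_bullet_mul, iterate_leafDeletion_eq_zero (Nat.lt_succ_self _)]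
  simp

theorem eta_bullet_pow_mul (k : ℕ) (x : ForestClass L) :
    eta (bullet L ^ k * x) * x.degree.factorial = (x.degree + k).factorial * eta x := by
  induction k with
  | zero => simp [mul_comm]
  | succ k ih =>
    rw [pow_succ', mul_assoc, eta_bullet_mul, ForestClass.degree_mul,
      ForestClass.degree_bullet_pow, mul_assoc, ih, ← add_assoc, Nat.factorial_succ]
    push_cast
    ring

theorem exists_iterate_leafDeletion_eq_zero (z : CK L) : ∃ r, (leafDeletion L)^[r] z = 0 := by
  induction z using MonoidAlgebra.induction_linear with
  | zero => exact ⟨0, rfl⟩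
  | add y z hy hz =>
    obtain ⟨r, hr⟩ := hy
    obtain ⟨s, hs⟩ := hz
    refine ⟨r + s, ?_⟩
    rw [← Module.End.coe_pow] at hr hs ⊢
    rw [map_add, pow_add, Module.End.mul_apply, Module.End.mul_apply, hs, map_zero, add_zero,
      ← Module.End.mul_apply, ← pow_add, add_comm, pow_add, Module.End.mul_apply, hr, map_zero]
  | single x a =>
    refine ⟨x.degree + 1, ?_⟩
    have hx : MonoidAlgebra.single x a = a • basisVec x := by simp [basisVec]
    rw [hx, ← Module.End.coe_pow, map_smul, Module.End.coe_pow,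
      iterate_leafDeletion_eq_zero (Nat.lt_succ_self _), smul_zero]

theorem isLeftRegular_basisVec_bullet : IsLeftRegular (basisVec (bullet L)) := by
  refine isLeftRegular_iff_right_eq_zero_of_mul.2 fun z hz => ?_
  obtain ⟨r, hr⟩ := exists_iterate_leafDeletion_eq_zero z
  induction r with
  | zero => exact hr
  | succ r ih =>
    have h := iterate_succ_leafDeletion_bullet_mul r z
    rw [hz, hr, mul_zero, add_zero, ← Module.End.coe_pow, map_zero] at h
    exact ih ((smul_eq_zero.1 h.symm).resolve_left (by positivity))

theorem ForestClass.isLeftRegular_bullet : IsLeftRegular (bullet L) := fun x y h =>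
  basisVec_injective <| isLeftRegular_basisVec_bullet <| by
    simpa only [basisVec_mul] using congrArg basisVec h

end LeafDeletion

section HookWalk

variable {L V W : Type*} {F : DForest L V} {S : Finset V}

/-- One step of the leaf-removal chain, applied to `f`: from `S` the leaf `u` is removed with
probability `η(S \ {u}) / η(S)`. -/
def leafStep (F : DForest L V) (f : Finset V → ℝ) (S : Finset V) : ℝ :=
  ∑ u ∈ leaves F S, eta (F.restrict (S.erase u)).toClass / eta (F.restrict S).toClass *
    f (S.erase u)

theorem leafStep_singleton (f : Finset V → ℝ) (v : V) : leafStep F f {v} = f ∅ := by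
  have hleaves : leaves F {v} = {v} := by
    ext u
    simp only [mem_leaves, Finset.mem_singleton, forall_eq, and_iff_left_iff_imp]
    rintro rfl
    exact F.not_isParent_self u
  have heta : eta (F.restrict {v}).toClass = 1 := by
    rw [eta_restrict_eq_sum_leaves F (Finset.singleton_nonempty v), hleaves, Finset.sum_singleton,
      Finset.erase_singleton, eta_restrict_empty]
  rw [leafStep, hleaves, Finset.sum_singleton, Finset.erase_singleton, heta, eta_restrict_empty,
    div_one, one_mul]

/-! ### The hook walk -/

/-- `S` is closed under taking parents. In a tree, the nonempty such sets are the rooted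
subtrees. -/
def ParentClosed (F : DForest L V) (S : Finset V) : Prop :=
  ∀ w v, F.IsParent w v → v ∈ S → w ∈ S

namespace ParentClosed

theorem mem_of_belowEq (hS : ParentClosed F S) {u v : V} (h : F.BelowEq u v) (hu : u ∈ S) :
    v ∈ S := by
  induction h using Relation.ReflTransGen.head_induction_on with
  | refl => exact hu
  | head h _ ih => exact hS _ _ h ih

theorem mem_leaves_iff (hS : ParentClosed F S) {v : V} :
    v ∈ leaves F S ↔ v ∈ S ∧ ∀ w ∈ S, ¬ F.Below w v := by
  refine mem_leaves.trans (and_congr_right fun _ => ⟨fun h w hw hwv => ?_, fun h w hw hvw => ?_⟩)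
  · obtain ⟨c, hvc, hwc⟩ := hwv.exists_child
    exact h c (hS.mem_of_belowEq hwc hw) hvc
  · exact h w hw hvw.below

theorem erase (hS : ParentClosed F S) {u : V} (hu : u ∈ leaves F S) :
    ParentClosed F (S.erase u) := by
  intro w v hwv hv
  have hvS := Finset.mem_of_mem_erase hv
  exact Finset.mem_erase.2 ⟨fun h => (mem_leaves.1 hu).2 v hvS (h ▸ hwv), hS w v hwv hvS⟩

theorem hookLength_leaf (hS : ParentClosed F S) {u : V} (hu : u ∈ leaves F S) :
    hookLength F S u = 1 := by
  obtain ⟨huS, hbelow⟩ := hS.mem_leaves_iff.1 hu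
  refine Finset.card_eq_one.2 ⟨u, Finset.ext fun w => ?_⟩
  rw [Finset.mem_filter, Finset.mem_singleton]
  constructor
  · rintro ⟨hw, h⟩
    exact (DForest.belowEq_iff.1 h).resolve_right (hbelow w hw)
  · rintro rfl
    exact ⟨huS, DForest.BelowEq.refl w⟩

end ParentClosed

theorem card_filter_below_add_one {v : V} (hv : v ∈ S) :
    {w ∈ S | F.Below w v}.card + 1 = hookLength F S v := by
  have hmem : v ∉ ({w ∈ S | F.Below w v} : Finset V) := by simp [F.not_below_self]
  rw [hookLength, ← Finset.card_insert_of_notMem hmem]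
  congr 1
  ext w
  simp only [Finset.mem_filter, Finset.mem_insert, DForest.belowEq_iff]
  grind

theorem two_le_hookLength {u v : V} (hu : u ∈ S) (hv : v ∈ S) (h : F.Below u v) :
    2 ≤ hookLength F S v :=
  (Nat.succ_le_of_lt (hookLength_pos hu)).trans_lt (hookLength_lt hv h)

theorem hookLength_erase {u v : V} (hu : u ∈ S) :
    hookLength F (S.erase u) v + (if F.BelowEq u v then 1 else 0) = hookLength F S v := by
  rw [hookLength, hookLength, Finset.filter_erase]
  split_ifs with h
  · exact Finset.card_erase_add_one (Finset.mem_filter.2 ⟨hu, h⟩)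
  · rw [Finset.erase_eq_of_notMem (by simp [h]), add_zero]

theorem DForest.belowEq_and_belowEq_iff_of_isParent {u c v w : V} (hp : F.IsParent v c)
    (hc : F.BelowEq u c) :
    F.BelowEq w v ∧ F.BelowEq u w ↔ w = v ∨ F.BelowEq w c ∧ F.BelowEq u w := by
  constructor
  · rintro ⟨hwv, huw⟩
    by_cases hne : w = v
    · exact Or.inl hne
    refine Or.inr ⟨(huw.total hc).elim id fun hcw => ?_, huw⟩
    by_cases hwc : c = w
    · exact hwc ▸ BelowEq.refl _
    · exact absurd ((hcw.below_of_ne hwc).belowEq_parent hp) (hwv.below_of_ne hne).not_belowEq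
  · rintro (rfl | ⟨hwc, huw⟩)
    · exact ⟨BelowEq.refl _, (hc.trans_below hp.below).belowEq⟩
    · exact ⟨(hwc.trans_below hp.below).belowEq, huw⟩

variable [Fintype V]

/-- The product of `h / (h - 1)` over the hook lengths `h` of the vertices strictly above `u`, up
to `v`. Divided by the hook length of `v`, it is the probability that the hook walk from `v` ends
in the leaf `u`. -/
def hookProd (F : DForest L V) (S : Finset V) (v u : V) : ℝ :=
  ∏ w with F.BelowEq w v ∧ F.Below u w, (hookLength F S w : ℝ) / (hookLength F S w - 1)

theorem hookProd_self (u : V) : hookProd F S u u = 1 := by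
  rw [hookProd, Finset.filter_false_of_mem, Finset.prod_empty]
  rintro w - ⟨hwu, huw⟩
  exact huw.not_belowEq hwu

theorem hookProd_parent {u c v : V} (hp : F.IsParent v c) (hc : F.BelowEq u c) :
    hookProd F S v u = (hookLength F S v : ℝ) / (hookLength F S v - 1) * hookProd F S c u := by
  have hinsert : (Finset.univ.filter fun w => F.BelowEq w v ∧ F.Below u w) =
      insert v (Finset.univ.filter fun w => F.BelowEq w c ∧ F.Below u w) := by
    ext w
    simp only [Finset.mem_filter, Finset.mem_univ, true_and, Finset.mem_insert]
    constructor
    · rintro ⟨hwv, huw⟩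
      exact ((DForest.belowEq_and_belowEq_iff_of_isParent hp hc).1 ⟨hwv, huw.belowEq⟩).imp_right
        fun h => ⟨h.1, huw⟩
    · rintro (rfl | ⟨hwc, huw⟩)
      · exact ⟨DForest.BelowEq.refl _, hc.trans_below hp.below⟩
      · exact ⟨(hwc.trans_below hp.below).belowEq, huw⟩
  rw [hookProd, hinsert, Finset.prod_insert (by simp [hp.below.not_belowEq]), hookProd]

theorem sum_hookProd_div_hookLength (hS : ParentClosed F S) {u v : V} (hu : u ∈ leaves F S)
    (huv : F.BelowEq u v) :
    ∑ w with F.BelowEq w v ∧ F.BelowEq u w, hookProd F S w u / hookLength F S w =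
      hookProd F S v u := by
  induction huv using Relation.ReflTransGen.head_induction_on with
  | refl =>
    have hsingle : (Finset.univ.filter fun w => F.BelowEq w u ∧ F.BelowEq u w) = {u} := by
      ext w
      simp only [Finset.mem_filter, Finset.mem_univ, true_and, Finset.mem_singleton]
      constructor
      · exact fun h => h.1.antisymm h.2
      · rintro rfl
        exact ⟨DForest.BelowEq.refl _, DForest.BelowEq.refl _⟩
    rw [hsingle, Finset.sum_singleton, hookProd_self, hS.hookLength_leaf hu, Nat.cast_one, div_one]
  | @head v c hp hc ih =>
    have hinsert : (Finset.univ.filter fun w => F.BelowEq w v ∧ F.BelowEq u w) =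
        insert v (Finset.univ.filter fun w => F.BelowEq w c ∧ F.BelowEq u w) := by
      ext w
      simp only [Finset.mem_filter, Finset.mem_univ, true_and, Finset.mem_insert]
      exact DForest.belowEq_and_belowEq_iff_of_isParent hp hc
    rw [hinsert, Finset.sum_insert (by simp [hp.below.not_belowEq]), ih, hookProd_parent hp hc]
    have huv : F.Below u v := DForest.BelowEq.trans_below hc hp.below
    have huS := mem_of_mem_leaves hu
    have hlen : (2 : ℝ) ≤ hookLength F S v := by
      exact_mod_cast two_le_hookLength huS (hS.mem_of_belowEq huv.belowEq huS) huv
    have hlen_sub : (hookLength F S v : ℝ) - 1 ≠ 0 := by linarith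
    have hlen_ne : (hookLength F S v : ℝ) ≠ 0 := by linarith
    field_simp
    ring

/-- The expected value of `f (S \ {u})`, where `u` is the leaf of `S` in which the hook walk from
`v` ends: the walk moves to a uniformly chosen vertex of `S` below the current one, until there is
none. -/
def hookWalk (F : DForest L V) (S : Finset V) (f : Finset V → ℝ) (v : V) : ℝ :=
  ∑ u ∈ leaves F S with F.BelowEq u v, hookProd F S v u / hookLength F S v * f (S.erase u)

theorem hookWalk_of_mem_leaves (hS : ParentClosed F S) (f : Finset V → ℝ) {v : V}
    (hv : v ∈ leaves F S) : hookWalk F S f v = f (S.erase v) := by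
  have hsingle : (leaves F S).filter (fun u => F.BelowEq u v) = {v} := by
    ext u
    rw [Finset.mem_filter, Finset.mem_singleton]
    constructor
    · rintro ⟨hu, huv⟩
      exact (DForest.belowEq_iff.1 huv).resolve_right
        ((hS.mem_leaves_iff.1 hv).2 u (mem_of_mem_leaves hu))
    · rintro rfl
      exact ⟨hv, DForest.BelowEq.refl u⟩
  rw [hookWalk, hsingle, Finset.sum_singleton, hookProd_self, hS.hookLength_leaf hv, Nat.cast_one,
    div_one, one_mul]

theorem sum_hookWalk_belowEq (hS : ParentClosed F S) (f : Finset V → ℝ) (v : V) :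
    ∑ w ∈ S with F.BelowEq w v, hookWalk F S f w = hookLength F S v * hookWalk F S f v := by
  by_cases hv : v ∈ S
  · unfold hookWalk
    rw [Finset.sum_comm' (t' := (leaves F S).filter fun u => F.BelowEq u v)
      (s' := fun u => Finset.univ.filter fun w => F.BelowEq w v ∧ F.BelowEq u w), Finset.mul_sum]
    · refine Finset.sum_congr rfl fun u hu => ?_
      obtain ⟨hu, huv⟩ := Finset.mem_filter.1 hu
      have hlen : (hookLength F S v : ℝ) ≠ 0 := by exact_mod_cast (hookLength_pos hv).ne'
      rw [← Finset.sum_mul, sum_hookProd_div_hookLength hS hu huv]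
      field_simp
    · intro w u
      simp only [Finset.mem_filter, Finset.mem_univ, true_and]
      constructor
      · rintro ⟨⟨-, hwv⟩, hu, huw⟩
        exact ⟨⟨hwv, huw⟩, hu, huw.trans hwv⟩
      · rintro ⟨⟨hwv, huw⟩, hu, -⟩
        exact ⟨⟨hS.mem_of_belowEq huw (mem_of_mem_leaves hu), hwv⟩, hu, huw⟩
  · have hnone : ∀ w ∈ S, ¬ F.BelowEq w v := fun w hw h => hv (hS.mem_of_belowEq h hw)
    rw [Finset.filter_false_of_mem hnone, hookWalk, Finset.filter_false_of_mem fun u hu =>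
      hnone u (mem_of_mem_leaves hu), Finset.sum_empty, Finset.sum_empty, mul_zero]

theorem sum_hookWalk_below (hS : ParentClosed F S) (f : Finset V → ℝ) {v : V} (hv : v ∈ S) :
    ∑ w ∈ S with F.Below w v, hookWalk F S f w = (hookLength F S v - 1) * hookWalk F S f v := by
  have hinsert : {w ∈ S | F.BelowEq w v} = insert v {w ∈ S | F.Below w v} := by
    ext w
    simp only [Finset.mem_filter, Finset.mem_insert, DForest.belowEq_iff]
    grind
  have h := sum_hookWalk_belowEq hS f v
  rw [hinsert, Finset.sum_insert (by simp [F.not_below_self])] at h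
  linarith

theorem hookWalk_one (hS : ParentClosed F S) {v : V} (hv : v ∈ S) :
    hookWalk F S (fun _ => 1) v = 1 := by
  induction hn : hookLength F S v using Nat.strong_induction_on generalizing v with
  | _ n ih =>
    subst hn
    by_cases hleaf : v ∈ leaves F S
    · rw [hookWalk_of_mem_leaves hS _ hleaf]
    · have hsum : ∑ w ∈ S with F.Below w v, hookWalk F S (fun _ => 1) w = hookLength F S v - 1 := by
        rw [Finset.sum_congr rfl fun w hw => ih _ (hookLength_lt hv (Finset.mem_filter.1 hw).2)
          (Finset.mem_filter.1 hw).1 rfl, ← card_filter_below_add_one hv]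
        simp
      obtain ⟨w, hw, hwv⟩ : ∃ w ∈ S, F.Below w v := by
        simpa [hS.mem_leaves_iff, hv] using hleaf
      have hlen : (2 : ℝ) ≤ hookLength F S v := by exact_mod_cast two_le_hookLength hw hv hwv
      rw [sum_hookWalk_below hS _ hv] at hsum
      exact mul_left_cancel₀ (by linarith) (hsum.trans (mul_one _).symm)

/-- The factor by which the product of the hook lengths of `S` shrinks when the leaf `u` is
deleted: the product of `h / (h - 1)` over the hook lengths `h` of all vertices strictly
above `u`. -/
def ancestorProd (F : DForest L V) (S : Finset V) (u : V) : ℝ :=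
  ∏ w with F.Below u w, (hookLength F S w : ℝ) / (hookLength F S w - 1)

theorem sum_hookWalk (hS : ParentClosed F S) (f : Finset V → ℝ) :
    ∑ v ∈ S, hookWalk F S f v = ∑ u ∈ leaves F S, ancestorProd F S u * f (S.erase u) := by
  unfold hookWalk
  rw [Finset.sum_comm' (t' := leaves F S) (s' := fun u => Finset.univ.filter (F.BelowEq u))]
  · refine Finset.sum_congr rfl fun u hu => ?_
    obtain ⟨r, hur, hr⟩ := F.exists_greatest_ancestor u
    have hprod : ancestorProd F S u = hookProd F S r u := by
      refine Finset.prod_congr (Finset.filter_congr fun w _ => ?_) fun _ _ => rfl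
      exact ⟨fun h => ⟨hr w h.belowEq, h⟩, And.right⟩
    rw [← Finset.sum_mul, hprod, ← sum_hookProd_div_hookLength hS hu hur]
    congr 2
    exact Finset.filter_congr fun w _ => ⟨fun h => ⟨hr w h, h⟩, And.right⟩
  · intro w u
    simp only [Finset.mem_filter, Finset.mem_univ, true_and]
    exact ⟨fun h => ⟨h.2.2, h.2.1⟩,
      fun h => ⟨hS.mem_of_belowEq h.1 (mem_of_mem_leaves h.2), h.2, h.1⟩⟩

theorem prod_hookLength_erase (hS : ParentClosed F S) {u : V} (hu : u ∈ leaves F S) :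
    ∏ v ∈ S, (hookLength F S v : ℝ) =
      ancestorProd F S u * ∏ v ∈ S.erase u, (hookLength F (S.erase u) v : ℝ) := by
  have huS := mem_of_mem_leaves hu
  have hprod : ancestorProd F S u = ∏ v ∈ S.erase u,
      if F.Below u v then (hookLength F S v : ℝ) / (hookLength F S v - 1) else 1 := by
    rw [← Finset.prod_filter]
    refine Finset.prod_congr (Finset.ext fun w => ?_) fun _ _ => rfl
    simp only [Finset.mem_filter, Finset.mem_univ, true_and, Finset.mem_erase]
    exact ⟨fun h => ⟨⟨h.ne.symm, hS.mem_of_belowEq h.belowEq huS⟩, h⟩, And.right⟩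
  rw [← Finset.mul_prod_erase S _ huS, hS.hookLength_leaf hu, Nat.cast_one, one_mul, hprod,
    ← Finset.prod_mul_distrib]
  refine Finset.prod_congr rfl fun v hv => ?_
  have hvu := Finset.ne_of_mem_erase hv
  rw [← hookLength_erase (F := F) (v := v) huS]
  by_cases h : F.Below u v
  · have hpos : (hookLength F (S.erase u) v : ℝ) ≠ 0 := by
      exact_mod_cast (hookLength_pos hv).ne'
    rw [if_pos h.belowEq, if_pos h]
    push_cast
    rw [add_sub_cancel_right, div_mul_cancel₀ _ hpos]
  · rw [if_neg h, if_neg fun h' => h (h'.below_of_ne hvu.symm), one_mul, add_zero]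

theorem eta_mul_prod_hookLength (hS : ParentClosed F S) :
    eta (F.restrict S).toClass * ∏ v ∈ S, (hookLength F S v : ℝ) = S.card.factorial := by
  induction S using Finset.strongInduction with
  | _ S ih =>
    obtain rfl | hne := S.eq_empty_or_nonempty
    · simp [eta_restrict_empty]
    have hcard : ∑ u ∈ leaves F S, ancestorProd F S u = S.card := by
      simpa [Finset.sum_congr rfl fun _ hv => hookWalk_one hS hv] using
        (sum_hookWalk hS fun _ => 1).symm
    have hstep : ∀ u ∈ leaves F S, eta (F.restrict (S.erase u)).toClass *
        ∏ v ∈ S, (hookLength F S v : ℝ) = ancestorProd F S u * (S.card - 1).factorial := by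
      intro u hu
      have huS := mem_of_mem_leaves hu
      rw [prod_hookLength_erase hS hu, mul_left_comm, ih _ (Finset.erase_ssubset huS) (hS.erase hu),
        Finset.card_erase_of_mem huS]
    rw [eta_restrict_eq_sum_leaves F hne, Finset.sum_mul, Finset.sum_congr rfl hstep,
      ← Finset.sum_mul, hcard, ← Nat.mul_factorial_pred (Finset.card_pos.2 hne).ne', Nat.cast_mul]

theorem sum_hookWalk_eq_card_mul_leafStep (hS : ParentClosed F S) (f : Finset V → ℝ) :
    ∑ v ∈ S, hookWalk F S f v = S.card * leafStep F f S := by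
  rw [sum_hookWalk hS, leafStep, Finset.mul_sum]
  refine Finset.sum_congr rfl fun u hu => ?_
  have huS := mem_of_mem_leaves hu
  have hcard : (S.card : ℝ) * (S.erase u).card.factorial = S.card.factorial := by
    rw [Finset.card_erase_of_mem huS]
    exact_mod_cast Nat.mul_factorial_pred (Finset.card_pos.2 ⟨u, huS⟩).ne'
  have heta := (eta_restrict_pos F S).ne'
  have hprod : ∏ v ∈ S.erase u, (hookLength F (S.erase u) v : ℝ) ≠ 0 :=
    Finset.prod_ne_zero_iff.2 fun v hv => by exact_mod_cast (hookLength_pos hv).ne'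
  rw [← eta_mul_prod_hookLength hS, ← eta_mul_prod_hookLength (hS.erase hu),
    prod_hookLength_erase hS hu] at hcard
  have hratio : ancestorProd F S u * eta (F.restrict S).toClass =
      S.card * eta (F.restrict (S.erase u)).toClass :=
    mul_right_cancel₀ hprod (by linarith)
  field_simp
  linear_combination f (S.erase u) * hratio

theorem hookWalk_eq_leafStep_of_forall_belowEq (hS : ParentClosed F S) (f : Finset V → ℝ) {r : V}
    (hrS : r ∈ S) (hr : ∀ v ∈ S, F.BelowEq v r) : hookWalk F S f r = leafStep F f S := by
  have h := sum_hookWalk_belowEq hS f r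
  rw [hookLength, Finset.filter_true_of_mem hr, sum_hookWalk_eq_card_mul_leafStep hS] at h
  exact (mul_left_cancel₀ (by exact_mod_cast (Finset.card_pos.2 ⟨r, hrS⟩).ne') h).symm

end HookWalk

/-! ### Expectations -/

section Expectation

variable {α β : Type*}

/-- The expected value of `f` under the discrete distribution `p`; the sum is finite in all uses. -/
def expect (p : PMF α) (f : α → ℝ) : ℝ := ∑' a, (p a).toReal * f a

theorem expect_congr {p : PMF α} {f g : α → ℝ} (h : ∀ a ∈ p.support, f a = g a) :
    expect p f = expect p g := by
  refine tsum_congr fun a => ?_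
  by_cases ha : a ∈ p.support
  · rw [h a ha]
  · rw [(p.apply_eq_zero_iff a).2 ha, ENNReal.toReal_zero, zero_mul, zero_mul]

theorem expect_pure (a : α) (f : α → ℝ) : expect (PMF.pure a) f = f a := by
  rw [expect, tsum_eq_single a fun b hb => by simp [PMF.pure_apply, hb]]
  simp

theorem expect_uniformOfFinset (s : Finset α) (hs : s.Nonempty) (f : α → ℝ) :
    expect (PMF.uniformOfFinset s hs) f = (∑ a ∈ s, f a) / s.card := by
  rw [expect, tsum_eq_sum (s := s) fun a ha => by
    simp [PMF.uniformOfFinset_apply_of_notMem hs ha], Finset.sum_div]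
  refine Finset.sum_congr rfl fun a ha => ?_
  rw [PMF.uniformOfFinset_apply_of_mem hs ha, ENNReal.toReal_inv, ENNReal.toReal_natCast,
    inv_mul_eq_div]

theorem expect_eq_sum_of_support_subset {p : PMF α} {s : Finset α} (hs : p.support ⊆ s)
    (f : α → ℝ) : expect p f = ∑ a ∈ s, (p a).toReal * f a :=
  tsum_eq_sum fun a ha => by
    rw [(p.apply_eq_zero_iff a).2 fun h => ha (hs h), ENNReal.toReal_zero, zero_mul]

theorem expect_bind [Finite β] {p : PMF α} (hp : p.support.Finite) (q : α → PMF β) (f : β → ℝ) :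
    expect (p.bind q) f = expect p fun a => expect (q a) f := by
  cases nonempty_fintype β
  have hs : p.support ⊆ hp.toFinset := hp.coe_toFinset.ge
  have hbind (b : β) : (p.bind q b).toReal =
      ∑ a ∈ hp.toFinset, (p a).toReal * (q a b).toReal := by
    rw [PMF.bind_apply, tsum_eq_sum (s := hp.toFinset) fun a ha => by
      rw [(p.apply_eq_zero_iff a).2 fun h => ha (hs h), zero_mul],
      ENNReal.toReal_sum fun a _ => ENNReal.mul_ne_top (p.apply_ne_top a) ((q a).apply_ne_top b)]
    simp only [ENNReal.toReal_mul]
  rw [expect_eq_sum_of_support_subset hs]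
  simp only [expect, tsum_fintype, hbind, Finset.sum_mul, Finset.mul_sum, mul_assoc]
  exact Finset.sum_comm

theorem expect_sum [Finite α] {ι : Type*} (p : PMF α) (s : Finset ι) (f : ι → α → ℝ) :
    expect p (fun a => ∑ i ∈ s, f i a) = ∑ i ∈ s, expect p (f i) := by
  cases nonempty_fintype α
  simp only [expect, tsum_fintype, Finset.mul_sum]
  exact Finset.sum_comm

theorem expect_const_mul (p : PMF α) (c : ℝ) (f : α → ℝ) :
    expect p (fun a => c * f a) = c * expect p f := by
  simp only [expect, mul_left_comm _ c, tsum_mul_left]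

theorem expect_map [Finite α] [Finite β] (p : PMF α) (g : α → β) (f : β → ℝ) :
    expect (p.map g) f = expect p fun a => f (g a) := by
  rw [← PMF.bind_pure_comp, expect_bind (Set.toFinite _)]
  simp only [Function.comp_apply, expect_pure]

end Expectation

section Promotions

/-! ### The cascade of promotions -/

variable {L V : Type*} {T : DForest L V} {S : Finset V} {pos pos' : Staffing V} {e v w : V}

/-- No two employees hold the same position. -/
def Proper (pos : Staffing V) : Prop := ∀ e e' v, pos e = some v → pos e' = some v → e = e'

theorem proper_startOfMonth (S : Finset V) : Proper (startOfMonth S) := by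
  intro a b v ha hb
  unfold startOfMonth at ha hb
  split_ifs at ha hb
  rw [Option.some.inj ha, Option.some.inj hb]

variable [Fintype V]

/-- The employees in the company. -/
def employed (pos : Staffing V) : Finset V := {e | ∃ v, pos e = some v}

theorem mem_employed : e ∈ employed pos ↔ ∃ v, pos e = some v := by simp [employed]

theorem mem_filled : v ∈ filled pos ↔ ∃ e, pos e = some v := by simp [filled]

theorem mem_subordinates {p : V × V} :
    p ∈ subordinates T pos v ↔ pos p.1 = some p.2 ∧ T.Below p.2 v := by simp [subordinates]

theorem filled_startOfMonth (S : Finset V) : filled (startOfMonth S) = S := by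
  ext v
  simp [mem_filled, startOfMonth]

theorem employed_startOfMonth (S : Finset V) : employed (startOfMonth S) = S := by
  ext v
  simp [mem_employed, startOfMonth]

theorem employed_update_some (h : e ∈ employed pos) (v : V) :
    employed (Function.update pos e (some v)) = employed pos := by
  ext a
  simp only [mem_employed, Function.update_apply] at h ⊢
  grind

theorem employed_update_none (pos : Staffing V) (e : V) :
    employed (Function.update pos e none) = (employed pos).erase e := by
  ext a
  simp only [mem_employed, Function.update_apply, Finset.mem_erase]
  grind

namespace Proper

theorem sum_employed (hp : Proper pos) {M : Type*} [AddCommMonoid M] {f g : V → M}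
    (hfg : ∀ e v, pos e = some v → f e = g v) :
    ∑ e ∈ employed pos, f e = ∑ v ∈ filled pos, g v := by
  have hpos : ∀ e ∈ employed pos, pos e = some ((pos e).getD e) := fun e he => by
    obtain ⟨v, hv⟩ := mem_employed.1 he
    rw [hv, Option.getD_some]
  refine Finset.sum_nbij (fun e => (pos e).getD e) (fun e he => mem_filled.2 ⟨e, hpos e he⟩) ?_ ?_
    fun e he => hfg _ _ (hpos e he)
  · exact fun e he e' he' h => hp _ _ _ (hpos e he) ((hpos e' he').trans (congrArg some h.symm))
  · intro v hv
    obtain ⟨e, he⟩ := mem_filled.1 hv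
    exact ⟨e, mem_employed.2 ⟨v, he⟩, by simp [he]⟩

theorem card_employed (hp : Proper pos) : (employed pos).card = (filled pos).card := by
  simpa only [Finset.card_eq_sum_ones] using hp.sum_employed (M := ℕ) fun _ _ _ => rfl

theorem sum_subordinates (hp : Proper pos) {M : Type*} [AddCommMonoid M] (v : V) (g : V → M) :
    ∑ p ∈ subordinates T pos v, g p.2 = ∑ w ∈ filled pos with T.Below w v, g w := by
  refine Finset.sum_nbij Prod.snd ?_ ?_ ?_ fun _ _ => rfl
  · intro p h
    rw [mem_subordinates] at h
    exact Finset.mem_filter.2 ⟨mem_filled.2 ⟨p.1, h.1⟩, h.2⟩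
  · intro p h p' h' heq
    rw [Finset.mem_coe, mem_subordinates] at h h'
    exact Prod.ext (hp _ _ _ h.1 (heq ▸ h'.1)) heq
  · intro w hw
    obtain ⟨hw, hwv⟩ := Finset.mem_filter.1 hw
    obtain ⟨e, he⟩ := mem_filled.1 hw
    exact ⟨(e, w), mem_subordinates.2 ⟨he, hwv⟩, rfl⟩

theorem card_subordinates (hp : Proper pos) (v : V) :
    (subordinates T pos v).card = {w ∈ filled pos | T.Below w v}.card := by
  simpa only [Finset.card_eq_sum_ones] using hp.sum_subordinates v fun _ => (1 : ℕ)

end Proper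

/-- All positions in `S` but the position `v` are filled, each by one employee. -/
structure Vacancy (S : Finset V) (v : V) (pos : Staffing V) : Prop where
  proper : Proper pos
  mem : v ∈ S
  filled_eq : filled pos = S.erase v

namespace Vacancy

theorem mem_of_pos_eq (h : Vacancy S v pos) (he : pos e = some w) : w ∈ S :=
  Finset.mem_of_mem_erase (h.filled_eq ▸ mem_filled.2 ⟨e, he⟩)

theorem pos_ne (h : Vacancy S v pos) (e : V) : pos e ≠ some v := fun he =>
  Finset.notMem_erase v S (h.filled_eq ▸ mem_filled.2 ⟨e, he⟩)

theorem filter_below_filled (h : Vacancy S v pos) :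
    {w ∈ filled pos | T.Below w v} = {w ∈ S | T.Below w v} := by
  rw [h.filled_eq, Finset.filter_erase, Finset.erase_eq_of_notMem (by simp [T.not_below_self])]

theorem of_fire (hp : Proper pos) (he : pos e = some v) :
    Vacancy (filled pos) v (Function.update pos e none) where
  proper a b x ha hb := by
    simp only [Function.update_apply] at ha hb
    grind [Proper]
  mem := mem_filled.2 ⟨e, he⟩
  filled_eq := by
    ext x
    simp only [mem_filled, Finset.mem_erase, Function.update_apply]
    grind [Proper]

theorem promote (h : Vacancy S v pos) (he : pos e = some w) :
    Vacancy S w (Function.update pos e (some v)) where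
  proper a b x ha hb := by
    have hp := h.proper
    have hv := h.pos_ne
    simp only [Function.update_apply] at ha hb
    grind [Proper]
  mem := h.mem_of_pos_eq he
  filled_eq := by
    have hp := h.proper
    have hv := h.pos_ne
    have hS : ∀ x, x ∈ S ↔ x = v ∨ ∃ a, pos a = some x := fun x => by
      rw [← mem_filled, h.filled_eq, ← Finset.mem_insert, Finset.insert_erase h.mem]
    ext x
    simp only [mem_filled, Finset.mem_erase, Function.update_apply, hS]
    grind [Proper]

theorem subordinates_nonempty_iff (h : Vacancy S v pos) (hS : ParentClosed T S) :
    (subordinates T pos v).Nonempty ↔ v ∉ leaves T S := by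
  rw [← Finset.card_pos, h.proper.card_subordinates, h.filter_below_filled, Finset.card_pos,
    Finset.filter_nonempty_iff, hS.mem_leaves_iff]
  grind [h.mem]

end Vacancy

theorem cascade_of_nonempty (h : (subordinates T pos v).Nonempty) :
    cascade T pos v = (PMF.uniformOfFinset _ h).bind fun p =>
      cascade T (Function.update pos p.1 (some v)) p.2 := by
  rw [cascade, dif_pos h, PMF.bindOnSupport_eq_bind]

theorem cascade_of_empty (h : ¬ (subordinates T pos v).Nonempty) :
    cascade T pos v = PMF.pure pos := by
  rw [cascade, dif_neg h]

theorem expect_cascade (hS : ParentClosed T S) (f : Finset V → ℝ) (h : Vacancy S v pos) :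
    expect (cascade T pos v) (fun pos' => f (filled pos')) = hookWalk T S f v := by
  induction hn : hookLength T S v using Nat.strong_induction_on generalizing v pos with
  | _ n ih =>
    subst hn
    by_cases hne : (subordinates T pos v).Nonempty
    · have hstep : ∀ p ∈ subordinates T pos v,
          expect (cascade T (Function.update pos p.1 (some v)) p.2) (fun pos' => f (filled pos')) =
            hookWalk T S f p.2 := fun p hp => by
        obtain ⟨hpos, hbelow⟩ := mem_subordinates.1 hp
        exact ih _ (hookLength_lt h.mem hbelow) (h.promote hpos) rfl
      have hcard : ((subordinates T pos v).card : ℝ) = hookLength T S v - 1 := by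
        rw [h.proper.card_subordinates, h.filter_below_filled, ← card_filter_below_add_one h.mem]
        simp
      have hcard_ne : ((subordinates T pos v).card : ℝ) ≠ 0 :=
        Nat.cast_ne_zero.2 (Finset.card_pos.2 hne).ne'
      rw [cascade_of_nonempty hne, expect_bind (Set.toFinite _), expect_uniformOfFinset,
        Finset.sum_congr rfl hstep, h.proper.sum_subordinates v (hookWalk T S f),
        h.filter_below_filled, sum_hookWalk_below hS f h.mem, ← hcard,
        mul_div_cancel_left₀ _ hcard_ne]
    · have hleaf : v ∈ leaves T S := not_not.1 ((h.subordinates_nonempty_iff hS).not.1 hne)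
      rw [cascade_of_empty hne, expect_pure, h.filled_eq, hookWalk_of_mem_leaves hS f hleaf]

theorem mem_support_cascade (hS : ParentClosed T S) (h : Vacancy S v pos)
    (h' : pos' ∈ (cascade T pos v).support) :
    employed pos' = employed pos ∧ ∃ u ∈ leaves T S, Vacancy S u pos' := by
  induction hn : hookLength T S v using Nat.strong_induction_on generalizing v pos with
  | _ n ih =>
    subst hn
    by_cases hne : (subordinates T pos v).Nonempty
    · rw [cascade_of_nonempty hne, PMF.mem_support_bind_iff] at h'
      obtain ⟨p, hp, hcascade⟩ := h'
      obtain ⟨hpos, hbelow⟩ := mem_subordinates.1 ((PMF.mem_support_uniformOfFinset_iff hne p).1 hp)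
      obtain ⟨hemp, hleaf⟩ := ih _ (hookLength_lt h.mem hbelow) (h.promote hpos) hcascade rfl
      exact ⟨hemp.trans (employed_update_some (mem_employed.2 ⟨_, hpos⟩) v), hleaf⟩
    · rw [cascade_of_empty hne, PMF.mem_support_pure_iff] at h'
      subst h'
      exact ⟨rfl, v, not_not.1 ((h.subordinates_nonempty_iff hS).not.1 hne), h⟩

/-! ### Firing -/

/-- The invariant of the firing process: every filled position has a filled parent position and
is held by one employee, and the company is not empty. -/
structure Orderly (T : DForest L V) (pos : Staffing V) : Prop where
  proper : Proper pos
  parentClosed : ParentClosed T (filled pos)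
  nonempty : (filled pos).Nonempty

theorem fire_of_one_lt (he : pos e = some v) (h : 1 < (filled pos).card) :
    fire T pos e = cascade T (Function.update pos e none) v := by
  simp only [fire, he, if_pos h]

theorem fire_of_card_le_one (e : V) (h : (filled pos).card ≤ 1) : fire T pos e = PMF.pure pos := by
  unfold fire
  split
  · rfl
  · rw [if_neg h.not_gt]

theorem fire_of_none (he : pos e = none) : fire T pos e = PMF.pure pos := by
  simp only [fire, he]

namespace Orderly

theorem startOfMonth (hS : ParentClosed T S) (hne : S.Nonempty) :
    Orderly T (startOfMonth S) where
  proper := proper_startOfMonth S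
  parentClosed := by rwa [filled_startOfMonth]
  nonempty := by rwa [filled_startOfMonth]

theorem expect_fire (h : Orderly T pos) (hcard : 1 < (filled pos).card) (f : Finset V → ℝ)
    (he : pos e = some v) :
    expect (fire T pos e) (fun pos' => f (filled pos')) = hookWalk T (filled pos) f v := by
  rw [fire_of_one_lt he hcard, expect_cascade h.parentClosed f (Vacancy.of_fire h.proper he)]

theorem fire_of_one_lt (h : Orderly T pos) (hcard : 1 < (filled pos).card) (he : e ∈ employed pos)
    (h' : pos' ∈ (fire T pos e).support) :
    Orderly T pos' ∧ employed pos' = (employed pos).erase e := by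
  obtain ⟨v, hv⟩ := mem_employed.1 he
  rw [CKTree.fire_of_one_lt hv hcard] at h'
  obtain ⟨hemp, u, hu, hvac⟩ :=
    mem_support_cascade h.parentClosed (Vacancy.of_fire h.proper hv) h'
  refine ⟨⟨hvac.proper, ?_, ?_⟩, hemp.trans (employed_update_none pos e)⟩
  · rw [hvac.filled_eq]
    exact h.parentClosed.erase hu
  · rw [hvac.filled_eq, ← Finset.card_pos, Finset.card_erase_of_mem hvac.mem]
    omega

theorem fire (h : Orderly T pos) (h' : pos' ∈ (fire T pos e).support) : Orderly T pos' := by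
  by_cases hfire : 1 < (filled pos).card ∧ e ∈ employed pos
  · exact (h.fire_of_one_lt hfire.1 hfire.2 h').1
  · have hpure : CKTree.fire T pos e = PMF.pure pos := by
      by_cases hcard : 1 < (filled pos).card
      · refine fire_of_none (Option.eq_none_iff_forall_ne_some.2 fun v hv => hfire ?_)
        exact ⟨hcard, mem_employed.2 ⟨v, hv⟩⟩
      · exact fire_of_card_le_one e (not_lt.1 hcard)
    rw [hpure, PMF.mem_support_pure_iff] at h'
    exact h' ▸ h

theorem fireList (h : Orderly T pos) {l : List V} (h' : pos' ∈ (fireList T pos l).support) :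
    Orderly T pos' := by
  induction l generalizing pos with
  | nil => exact (PMF.mem_support_pure_iff _ _).1 h' ▸ h
  | cons e l ih =>
    obtain ⟨pos₁, h₁, h₂⟩ := (PMF.mem_support_bind_iff _ _ _).1 h'
    exact ih (h.fire h₁) h₂

theorem fireSet (h : Orderly T pos) {F : Finset V} (h' : pos' ∈ (fireSet T pos F).support) :
    Orderly T pos' := by
  obtain ⟨l, -, hl⟩ := (PMF.mem_support_bind_iff _ _ _).1 h'
  exact h.fireList hl

end Orderly

end Promotions

section FiringSets

/-! ### Firing a random set of employees -/

variable {L V : Type*} {T : DForest L V} {S S' F : Finset V} {pos pos' : Staffing V} {e v : V}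

theorem mem_permutations_toList {l : List V} :
    l ∈ F.toList.permutations.toFinset ↔ l.Nodup ∧ l.toFinset = F := by
  rw [List.mem_toFinset, List.mem_permutations]
  constructor
  · exact fun h =>
      ⟨h.nodup_iff.2 F.nodup_toList, (List.toFinset_eq_of_perm _ _ h).trans F.toList_toFinset⟩
  · rintro ⟨hl, rfl⟩
    exact (List.toFinset_toList hl).symm

theorem card_permutations_toList (F : Finset V) :
    F.toList.permutations.toFinset.card = F.card.factorial := by
  rw [List.toFinset_card_of_nodup (List.nodup_permutations _ F.nodup_toList),
    List.length_permutations, Finset.length_toList]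

theorem sum_permutations {M : Type*} [AddCommMonoid M] (hF : F.Nonempty) (g : List V → M) :
    ∑ l ∈ F.toList.permutations.toFinset, g l =
      ∑ e ∈ F, ∑ l ∈ (F.erase e).toList.permutations.toFinset, g (e :: l) := by
  rw [Finset.sum_sigma']
  refine (Finset.sum_nbij (fun p : Σ _ : V, List V => p.1 :: p.2) ?_ ?_ ?_ fun _ _ => rfl).symm
  · rintro ⟨e, l⟩ h
    obtain ⟨he, hl⟩ := Finset.mem_sigma.1 h
    obtain ⟨hnodup, hfin⟩ := mem_permutations_toList.1 hl
    refine mem_permutations_toList.2 ⟨List.nodup_cons.2 ⟨fun hel => ?_, hnodup⟩, ?_⟩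
    · exact Finset.notMem_erase e F (hfin ▸ List.mem_toFinset.2 hel)
    · rw [List.toFinset_cons, hfin, Finset.insert_erase he]
  · rintro ⟨e, l⟩ - ⟨e', l'⟩ - h
    obtain ⟨rfl, rfl⟩ := List.cons.inj h
    rfl
  · intro l hl
    obtain ⟨hnodup, hfin⟩ := mem_permutations_toList.1 (Finset.mem_coe.1 hl)
    cases l with
    | nil => exact absurd hfin.symm hF.ne_empty
    | cons e l =>
      obtain ⟨hel, hnodup⟩ := List.nodup_cons.1 hnodup
      rw [List.toFinset_cons] at hfin
      refine ⟨⟨e, l⟩, Finset.mem_coe.2 (Finset.mem_sigma.2 ⟨?_, ?_⟩), rfl⟩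
      · exact hfin ▸ Finset.mem_insert_self e _
      · refine mem_permutations_toList.2 ⟨hnodup, ?_⟩
        rw [← hfin, Finset.erase_insert (mt List.mem_toFinset.1 hel)]

theorem sum_powersetCard_succ {M : Type*} [AddCommMonoid M] (E : Finset V) (k : ℕ)
    (g : V → Finset V → M) :
    ∑ F ∈ E.powersetCard (k + 1), ∑ e ∈ F, g e (F.erase e) =
      ∑ e ∈ E, ∑ F ∈ (E.erase e).powersetCard k, g e F := by
  rw [Finset.sum_sigma', Finset.sum_sigma']
  refine Finset.sum_bij' (fun p _ => ⟨p.2, p.1.erase p.2⟩) (fun p _ => ⟨insert p.1 p.2, p.1⟩)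
    ?_ ?_ ?_ ?_ fun _ _ => rfl
  all_goals
    rintro ⟨_, _⟩ h
    simp only [Finset.mem_sigma, Finset.mem_powersetCard] at h ⊢
  · obtain ⟨⟨hFE, hcard⟩, he⟩ := h
    exact ⟨hFE he, Finset.erase_subset_erase _ hFE, by rw [Finset.card_erase_of_mem he, hcard]; rfl⟩
  · obtain ⟨he, hFE, hcard⟩ := h
    have hnot := fun hF => Finset.notMem_erase _ _ (hFE hF)
    exact ⟨⟨Finset.insert_subset he (hFE.trans (Finset.erase_subset _ _)),
      by rw [Finset.card_insert_of_notMem hnot, hcard]⟩, Finset.mem_insert_self _ _⟩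
  · rw [Finset.insert_erase h.2]
  · rw [Finset.erase_insert fun hF => Finset.notMem_erase _ _ (h.2.1 hF)]

variable [Fintype V]

theorem fireList_of_card_le_one (h : (filled pos).card ≤ 1) (l : List V) :
    fireList T pos l = PMF.pure pos := by
  induction l with
  | nil => rfl
  | cons e l ih => rw [fireList, fire_of_card_le_one e h, PMF.pure_bind, ih]

theorem fireSet_of_card_le_one (h : (filled pos).card ≤ 1) (F : Finset V) :
    fireSet T pos F = PMF.pure pos := by
  simp only [fireSet, fireList_of_card_le_one h, PMF.bind_const]

theorem expect_fireSet (pos : Staffing V) (F : Finset V) (f : Staffing V → ℝ) :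
    expect (fireSet T pos F) f =
      (∑ l ∈ F.toList.permutations.toFinset, expect (fireList T pos l) f) / F.card.factorial := by
  rw [← card_permutations_toList]
  refine (expect_bind ?_ _ _).trans (expect_uniformOfFinset _ _ _)
  exact (PMF.support_uniformOfFinset _).symm ▸ Finset.finite_toSet _

theorem expect_fireSet_of_nonempty (hF : F.Nonempty) (f : Staffing V → ℝ) :
    expect (fireSet T pos F) f =
      (∑ e ∈ F, expect (fire T pos e) fun pos' => expect (fireSet T pos' (F.erase e)) f) /
        F.card := by
  have hterm : ∀ e ∈ F, expect (fire T pos e) (fun pos' => expect (fireSet T pos' (F.erase e)) f) =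
      (∑ l ∈ (F.erase e).toList.permutations.toFinset, expect (fireList T pos (e :: l)) f) /
        (F.card - 1).factorial := fun e he => by
    simp only [expect_fireSet, fireList, expect_bind (Set.toFinite _), ← expect_sum,
      Finset.card_erase_of_mem he, div_eq_inv_mul, expect_const_mul]
  rw [Finset.sum_congr rfl hterm, ← Finset.sum_div,
    ← sum_permutations hF fun l => expect (fireList T pos l) f, div_div, expect_fireSet,
    ← Nat.cast_mul, mul_comm, Nat.mul_factorial_pred (Finset.card_pos.2 hF).ne']

theorem sum_powersetCard_expect_fireSet (pos : Staffing V) (E : Finset V) (k : ℕ)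
    (f : Staffing V → ℝ) :
    ∑ F ∈ E.powersetCard (k + 1), expect (fireSet T pos F) f =
      (∑ e ∈ E, ∑ F ∈ (E.erase e).powersetCard k,
        expect (fire T pos e) fun pos' => expect (fireSet T pos' F) f) / (k + 1 : ℕ) := by
  rw [← sum_powersetCard_succ, Finset.sum_div]
  refine Finset.sum_congr rfl fun F hF => ?_
  have hcard := (Finset.mem_powersetCard.1 hF).2
  rw [expect_fireSet_of_nonempty (Finset.card_pos.1 (by omega)), hcard]

namespace Orderly

theorem exists_filled_eq_singleton (h : Orderly T pos) (hcard : (filled pos).card ≤ 1) :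
    ∃ v, filled pos = {v} :=
  Finset.card_eq_one.1 (hcard.antisymm (Finset.card_pos.2 h.nonempty))

theorem sum_expect_fire (h : Orderly T pos) (f : Finset V → ℝ)
    (hf : (filled pos).card ≤ 1 → f ∅ = f (filled pos)) :
    ∑ e ∈ employed pos, expect (CKTree.fire T pos e) (fun pos' => f (filled pos')) =
      (filled pos).card * leafStep T f (filled pos) := by
  by_cases hcard : 1 < (filled pos).card
  · rw [h.proper.sum_employed fun e v he => h.expect_fire hcard f he,
      sum_hookWalk_eq_card_mul_leafStep h.parentClosed]
  · rw [not_lt] at hcard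
    obtain ⟨v, hv⟩ := h.exists_filled_eq_singleton hcard
    simp only [fire_of_card_le_one _ hcard, expect_pure, Finset.sum_const, h.proper.card_employed,
      nsmul_eq_mul]
    rw [← hf hcard, hv, leafStep_singleton]

theorem sum_expect_fireSet_of_card_le_one (h : Orderly T pos) (hcard : (filled pos).card ≤ 1)
    (f : Finset V → ℝ) (hf : ∀ v, f ∅ = f {v}) (k : ℕ) :
    ∑ F ∈ (employed pos).powersetCard k,
        expect (CKTree.fireSet T pos F) (fun pos' => f (filled pos')) =
      (filled pos).card.choose k * (leafStep T)^[k] f (filled pos) := by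
  obtain ⟨v, hv⟩ := h.exists_filled_eq_singleton hcard
  simp only [fireSet_of_card_le_one hcard, expect_pure, Finset.sum_const, Finset.card_powersetCard,
    h.proper.card_employed, nsmul_eq_mul, hv, Finset.card_singleton]
  match k with
  | 0 => rfl
  | 1 => rw [Function.iterate_one, leafStep_singleton, hf v]
  | k + 2 => rw [Nat.choose_eq_zero_of_lt (by omega), Nat.cast_zero, zero_mul, zero_mul]

theorem sum_expect_fireSet (h : Orderly T pos) (f : Finset V → ℝ) (hf : ∀ v, f ∅ = f {v}) (k : ℕ) :
    ∑ F ∈ (employed pos).powersetCard k,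
        expect (CKTree.fireSet T pos F) (fun pos' => f (filled pos')) =
      (filled pos).card.choose k * (leafStep T)^[k] f (filled pos) := by
  induction k generalizing pos with
  | zero => simp [expect_fireSet, CKTree.fireList, expect_pure]
  | succ k ih =>
    by_cases hcard : 1 < (filled pos).card
    · have hstep : ∀ e ∈ employed pos, ∑ F ∈ ((employed pos).erase e).powersetCard k,
          expect (CKTree.fire T pos e)
            (fun pos' => expect (CKTree.fireSet T pos' F) fun pos'' => f (filled pos'')) =
          ((filled pos).card - 1).choose k *
            expect (CKTree.fire T pos e) fun pos' => (leafStep T)^[k] f (filled pos') := by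
        intro e he
        rw [← expect_sum, ← expect_const_mul]
        refine expect_congr fun pos' h' => ?_
        obtain ⟨horderly, hemp⟩ := h.fire_of_one_lt hcard he h'
        rw [← hemp, ih horderly, ← horderly.proper.card_employed, hemp,
          Finset.card_erase_of_mem he, h.proper.card_employed]
      obtain ⟨m, hm⟩ := Nat.exists_eq_add_one.2 (zero_lt_one.trans hcard)
      have hchoose : ((m + 1 : ℕ) : ℝ) * m.choose k = (m + 1).choose (k + 1) * (k + 1 : ℕ) :=
        mod_cast Nat.add_one_mul_choose_eq m k
      rw [sum_powersetCard_expect_fireSet, Finset.sum_congr rfl hstep, ← Finset.mul_sum,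
        h.sum_expect_fire _ fun hle => absurd hle hcard.not_ge, Function.iterate_succ_apply', hm,
        Nat.add_sub_cancel, div_eq_iff (by positivity)]
      linear_combination leafStep T ((leafStep T)^[k] f) (filled pos) * hchoose
    · exact h.sum_expect_fireSet_of_card_le_one (not_lt.1 hcard) f hf (k + 1)

end Orderly

end FiringSets

section Models

variable {L V : Type*} {T : DForest L V} {S S' F : Finset V} {pos pos' : Staffing V} {e v : V}

/-! ### The two models -/

theorem restrict_Icc_Iio {a : ℝ} (ha : a ≤ 1) :
    (MeasureTheory.volume.restrict (Set.Icc (0 : ℝ) 1)) (Set.Iio a) = ENNReal.ofReal a := by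
  have hinter : Set.Iio a ∩ Set.Icc 0 1 = Set.Ico 0 a := by
    ext x
    simp only [Set.mem_inter_iff, Set.mem_Iio, Set.mem_Icc, Set.mem_Ico]
    grind
  rw [MeasureTheory.Measure.restrict_apply measurableSet_Iio, hinter, Real.volume_Ico, sub_zero]

theorem restrict_Icc_Ici {a : ℝ} (ha : 0 ≤ a) :
    (MeasureTheory.volume.restrict (Set.Icc (0 : ℝ) 1)) (Set.Ici a) = ENNReal.ofReal (1 - a) := by
  have hinter : Set.Ici a ∩ Set.Icc 0 1 = Set.Icc a 1 := by
    ext x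
    simp only [Set.mem_inter_iff, Set.mem_Ici, Set.mem_Icc]
    grind
  rw [MeasureTheory.Measure.restrict_apply measurableSet_Ici, hinter, Real.volume_Icc]

theorem underperformProb_eq {q : ℝ} (hq₀ : 0 ≤ q) (hq₁ : q ≤ 1) (hF : F ⊆ S) :
    underperformProb q S F = (1 - q) ^ F.card * q ^ (S.card - F.card) := by
  have hpi : {perf : {e // e ∈ S} → ℝ | ∀ e, perf e < 1 - q ↔ (e : V) ∈ F} =
      Set.pi Set.univ fun e : {e // e ∈ S} =>
        if (e : V) ∈ F then Set.Iio (1 - q) else Set.Ici (1 - q) := by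
    ext perf
    simp only [Set.mem_ofPred_eq, Set.mem_pi, Set.mem_univ, true_imp_iff]
    refine forall_congr' fun e => ?_
    split_ifs with he <;> simp [he]
  have hfactor (e : {e // e ∈ S}) : ((MeasureTheory.volume.restrict (Set.Icc (0 : ℝ) 1))
      (if (e : V) ∈ F then Set.Iio (1 - q) else Set.Ici (1 - q))).toReal =
      if (e : V) ∈ F then 1 - q else q := by
    split_ifs
    · rw [restrict_Icc_Iio (sub_le_self 1 hq₀), ENNReal.toReal_ofReal (sub_nonneg.2 hq₁)]
    · rw [restrict_Icc_Ici (sub_nonneg.2 hq₁), sub_sub_cancel, ENNReal.toReal_ofReal hq₀]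
  rw [underperformProb, hpi, MeasureTheory.measureReal_def, MeasureTheory.Measure.pi_pi,
    ENNReal.toReal_prod, Finset.prod_congr rfl fun e _ => hfactor e,
    Finset.prod_coe_sort S fun e => if e ∈ F then 1 - q else q, Finset.prod_ite,
    Finset.prod_const, Finset.prod_const, Finset.filter_mem_eq_inter, Finset.inter_eq_right.2 hF,
    Finset.filter_notMem_eq_sdiff, Finset.card_sdiff_of_subset hF]

variable [Fintype V]

theorem sum_map_filled_mul (p : PMF (Staffing V)) (g : Finset V → ℝ) :
    ∑ S', (p.map filled S').toReal * g S' = expect p fun pos => g (filled pos) :=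
  (tsum_fintype _).symm.trans (expect_map p filled g)

theorem exists_mem_support_of_map_filled_ne_zero {p : PMF (Staffing V)}
    (h : (p.map filled S').toReal ≠ 0) : ∃ pos ∈ p.support, filled pos = S' :=
  (PMF.mem_support_map_iff _ _ _).1 <| (PMF.mem_support_iff _ _).2 fun h0 =>
    h (by rw [h0, ENNReal.toReal_zero])

theorem sum_uniformFiring_mul (C S : Finset V) (g : Finset V → ℝ) :
    ∑ S', uniformFiring T C S S' * g S' =
      (∑ e ∈ C, expect (fire T (startOfMonth S) e) fun pos => g (filled pos)) / C.card := by
  simp only [uniformFiring, Finset.sum_mul, mul_assoc, ← sum_map_filled_mul]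
  rw [Finset.sum_comm, Finset.sum_div]
  refine Finset.sum_congr rfl fun e _ => ?_
  rw [← Finset.mul_sum, one_div_mul_eq_div]

theorem sum_uniformFiring_self_mul (hS : ParentClosed T S) (hne : S.Nonempty) (g : Finset V → ℝ)
    (hg : ∀ v, g ∅ = g {v}) : ∑ S', uniformFiring T S S S' * g S' = leafStep T g S := by
  have h := (Orderly.startOfMonth hS hne).sum_expect_fire g fun hcard => by
    obtain ⟨v, hv⟩ := (Orderly.startOfMonth hS hne).exists_filled_eq_singleton hcard
    rw [hv, hg v]
  rw [employed_startOfMonth, filled_startOfMonth] at h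
  rw [sum_uniformFiring_mul, h,
    mul_div_cancel_left₀ _ (Nat.cast_ne_zero.2 (Finset.card_pos.2 hne).ne')]

theorem sum_singleModel_mul (hS : ParentClosed T S) (hne : S.Nonempty) (g : Finset V → ℝ)
    (hg : ∀ v, g ∅ = g {v}) :
    ∑ S', singleModel T S S' * g S' =
      (S.card : ℝ) / Fintype.card V * leafStep T g S +
        ((Fintype.card V : ℝ) - S.card) / Fintype.card V * g S := by
  simp only [singleModel, Matrix.of_apply, add_mul, Finset.sum_add_distrib, mul_assoc,
    ← Finset.mul_sum, sum_uniformFiring_self_mul hS hne g hg, ite_mul, one_mul, zero_mul,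
    Finset.sum_ite_eq', Finset.mem_univ, if_true]

theorem sum_binomialModel_mul {q : ℝ} (hq₀ : 0 ≤ q) (hq₁ : q ≤ 1) (hS : ParentClosed T S)
    (hne : S.Nonempty) (g : Finset V → ℝ) (hg : ∀ v, g ∅ = g {v}) :
    ∑ S', binomialModel T q S S' * g S' = ∑ k ∈ Finset.range (S.card + 1),
      S.card.choose k * (1 - q) ^ k * q ^ (S.card - k) * (leafStep T)^[k] g S := by
  have hexpect : ∑ S', binomialModel T q S S' * g S' = ∑ F ∈ S.powerset, underperformProb q S F *
      expect (fireSet T (startOfMonth S) F) fun pos => g (filled pos) := by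
    simp only [binomialModel, Matrix.of_apply, Finset.sum_mul, mul_assoc, ← sum_map_filled_mul,
      Finset.mul_sum]
    exact Finset.sum_comm
  rw [hexpect, Finset.sum_powerset]
  refine Finset.sum_congr rfl fun k _ => ?_
  have h := (Orderly.startOfMonth hS hne).sum_expect_fireSet g hg k
  rw [employed_startOfMonth, filled_startOfMonth] at h
  have hprob : ∀ F ∈ S.powersetCard k, underperformProb q S F = (1 - q) ^ k * q ^ (S.card - k) :=
    fun F hF => by
      obtain ⟨hFS, hcard⟩ := Finset.mem_powersetCard.1 hF
      rw [underperformProb_eq hq₀ hq₁ hFS, hcard]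
  rw [Finset.sum_congr rfl fun F hF => by rw [hprob F hF], ← Finset.mul_sum, h]
  ring

theorem parentClosed_of_singleModel_ne_zero (hS : ParentClosed T S) (hne : S.Nonempty)
    (h : singleModel T S S' ≠ 0) : ParentClosed T S' ∧ S'.Nonempty := by
  by_cases hSS : S' = S
  · exact hSS ▸ ⟨hS, hne⟩
  · simp only [singleModel, Matrix.of_apply, hSS, if_false, mul_zero, add_zero, uniformFiring] at h
    obtain ⟨e, -, he⟩ := Finset.exists_ne_zero_of_sum_ne_zero (right_ne_zero_of_mul h)
    obtain ⟨pos, hpos, rfl⟩ := exists_mem_support_of_map_filled_ne_zero (right_ne_zero_of_mul he)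
    have horderly := (Orderly.startOfMonth hS hne).fire hpos
    exact ⟨horderly.parentClosed, horderly.nonempty⟩

theorem parentClosed_of_binomialModel_ne_zero {q : ℝ} (hS : ParentClosed T S) (hne : S.Nonempty)
    (h : binomialModel T q S S' ≠ 0) : ParentClosed T S' ∧ S'.Nonempty := by
  obtain ⟨F, -, hF⟩ := Finset.exists_ne_zero_of_sum_ne_zero h
  obtain ⟨pos, hpos, rfl⟩ := exists_mem_support_of_map_filled_ne_zero (right_ne_zero_of_mul hF)
  have horderly := (Orderly.startOfMonth hS hne).fireSet hpos
  exact ⟨horderly.parentClosed, horderly.nonempty⟩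

theorem uniformFiring_eq_sum_hookWalk (hS : ParentClosed T S) (hcard : 1 < S.card)
    {C : Finset V} (hC : C ⊆ S) (S' : Finset V) :
    uniformFiring T C S S' =
      (∑ e ∈ C, hookWalk T S (fun A => if A = S' then 1 else 0) e) / C.card := by
  have h := sum_uniformFiring_mul (T := T) C S fun A => if A = S' then 1 else 0
  simp only [mul_ite, mul_one, mul_zero, Finset.sum_ite_eq', Finset.mem_univ, if_true] at h
  rw [h]
  refine congrArg (· / (C.card : ℝ)) (Finset.sum_congr rfl fun e he => ?_)
  have horderly := Orderly.startOfMonth hS (Finset.card_pos.1 (zero_lt_one.trans hcard))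
  rw [horderly.expect_fire (by rwa [filled_startOfMonth]) (fun A => if A = S' then 1 else 0)
    (if_pos (hC he)), filled_startOfMonth]

theorem uniformFiring_erase_root (hS : ParentClosed T S) (hcard : 1 < S.card) {r : V} (hrS : r ∈ S)
    (hr : ∀ v ∈ S, T.BelowEq v r) (S' : Finset V) :
    uniformFiring T S S S' = uniformFiring T (S.erase r) S S' := by
  have hpred_pos : (0 : ℝ) < S.card - 1 := sub_pos.2 (mod_cast hcard)
  rw [uniformFiring_eq_sum_hookWalk hS hcard subset_rfl,
    uniformFiring_eq_sum_hookWalk hS hcard (S.erase_subset r), Finset.sum_erase_eq_sub hrS,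
    sum_hookWalk_eq_card_mul_leafStep hS, hookWalk_eq_leafStep_of_forall_belowEq hS _ hrS hr,
    Finset.card_erase_of_mem hrS, Nat.cast_pred (zero_lt_one.trans hcard)]
  field_simp

end Models

/-! ### The top-to-random operators -/

section Operators

variable {L : Type*}

theorem T2R_basisVec (x : ForestClass L) :
    T2R L x.degree (basisVec x) =
      (1 / (x.degree : ℝ)) • (basisVec (bullet L) * leafDeletion L (basisVec x)) := by
  have h := descentOp_replicate_one_append_sub x 1
  rw [pow_one, Function.iterate_one] at h
  rw [← h]
  rfl

theorem bullet_mul_leafDeletion_bullet_pow_mul (k : ℕ) (z : CK L) :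
    basisVec (bullet L) * leafDeletion L (basisVec (bullet L) ^ k * z) =
      (k : ℝ) • (basisVec (bullet L) ^ k * z) +
        basisVec (bullet L) ^ (k + 1) * leafDeletion L z := by
  induction k with
  | zero => simp
  | succ k ih =>
    rw [pow_succ', mul_assoc, leafDeletion_mul, leafDeletion_bullet, one_mul, ih, mul_add, mul_add,
      mul_smul_comm, pow_succ' _ (k + 1), mul_assoc]
    push_cast
    module

theorem bullet_pow_mul_iterate_leafDeletion_bullet_mul (r : ℕ) (z : CK L) :
    basisVec (bullet L) ^ (r + 1) * (leafDeletion L)^[r + 1] (basisVec (bullet L) * z) =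
      (r + 1 : ℝ) • (basisVec (bullet L) * (basisVec (bullet L) ^ r * (leafDeletion L)^[r] z)) +
        basisVec (bullet L) * (basisVec (bullet L) ^ (r + 1) * (leafDeletion L)^[r + 1] z) := by
  rw [iterate_succ_leafDeletion_bullet_mul, mul_add, mul_smul_comm, pow_succ', mul_assoc,
    mul_assoc, mul_left_comm (basisVec (bullet L) ^ r), mul_assoc]

theorem BinT2R_basisVec (x : ForestClass L) (q : ℝ) :
    BinT2R L x.degree q (basisVec x) = ∑ r ∈ Finset.range (x.degree + 1),
      (1 / (r.factorial : ℝ) * (1 - q) ^ r * q ^ (x.degree - r)) •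
        (basisVec (bullet L) ^ r * (leafDeletion L)^[r] (basisVec x)) := by
  simp only [BinT2R, LinearMap.sum_apply, LinearMap.smul_apply, descentOp_replicate_one_append_sub]

/-- By the Leibniz rule, this is the recursion `(r + 1) β (n + 1) (r + 1) + β (n + 1) r = β n r` of
the coefficients `β n r = (1 - q) ^ r q ^ (n - r) / r!`. -/
theorem BinT2R_bullet_mul (x : ForestClass L) (q : ℝ) :
    BinT2R L (x.degree + 1) q (basisVec (bullet L * x)) =
      basisVec (bullet L) * BinT2R L x.degree q (basisVec x) := by
  set n := x.degree
  have hdeg : (bullet L * x).degree = n + 1 := by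
    rw [ForestClass.degree_mul, add_comm]
    rfl
  set β : ℕ → ℕ → ℝ := fun n r => 1 / (r.factorial : ℝ) * (1 - q) ^ r * q ^ (n - r) with hβ
  have hβ_succ : ∀ r ∈ Finset.range (n + 1), (r + 1) * β (n + 1) (r + 1) + β (n + 1) r = β n r := by
    intro r hr
    have hr' : r ≤ n := Finset.mem_range_succ_iff.1 hr
    simp only [hβ, Nat.factorial_succ, Nat.add_sub_add_right, Nat.succ_sub hr', pow_succ]
    push_cast
    field_simp
    ring
  set b : CK L := basisVec (bullet L)
  set P : ℕ → CK L := fun r => b * (b ^ r * (leafDeletion L)^[r] (basisVec x)) with hP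
  have hP_eq_zero : P (n + 1) = 0 := by
    simp [hP, iterate_leafDeletion_eq_zero (Nat.lt_succ_self n)]
  have hLeibniz : ∀ r, b ^ (r + 1) * (leafDeletion L)^[r + 1] (b * basisVec x) =
      (r + 1 : ℝ) • P r + P (r + 1) :=
    fun r => bullet_pow_mul_iterate_leafDeletion_bullet_mul r _
  have hleft := BinT2R_basisVec (bullet L * x) q
  rw [hdeg, basisVec_mul] at hleft
  rw [basisVec_mul, BinT2R_basisVec, hleft, Finset.mul_sum]
  calc ∑ r ∈ Finset.range (n + 1 + 1), β (n + 1) r • (b ^ r * (leafDeletion L)^[r] (b * basisVec x))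
      = ∑ r ∈ Finset.range (n + 1), β (n + 1) (r + 1) • ((r + 1 : ℝ) • P r) +
          ∑ r ∈ Finset.range (n + 1 + 1), β (n + 1) r • P r := by
        rw [Finset.sum_range_succ', Finset.sum_range_succ' _ (n + 1), ← add_assoc,
          ← Finset.sum_add_distrib]
        simp only [hLeibniz, smul_add]
        simp [hP]
    _ = ∑ r ∈ Finset.range (n + 1), β n r • P r := by
        rw [Finset.sum_range_succ _ (n + 1), hP_eq_zero, smul_zero, add_zero,
          ← Finset.sum_add_distrib]
        refine Finset.sum_congr rfl fun r hr => ?_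
        rw [smul_smul, ← add_smul, mul_comm, hβ_succ r hr]
    _ = ∑ r ∈ Finset.range (n + 1), b * β n r • (b ^ r * (leafDeletion L)^[r] (basisVec x)) := by
        simp only [hP, mul_smul_comm]

theorem BinT2R_bullet_pow_mul (k : ℕ) (x : ForestClass L) (q : ℝ) :
    BinT2R L (k + x.degree) q (basisVec (bullet L ^ k * x)) =
      basisVec (bullet L) ^ k * BinT2R L x.degree q (basisVec x) := by
  induction k with
  | zero => simp
  | succ k ih =>
    have h := BinT2R_bullet_mul (bullet L ^ k * x) q
    rw [ForestClass.degree_mul, ForestClass.degree_bullet_pow, ih] at h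
    rw [pow_succ', pow_succ', mul_assoc, mul_assoc, ← h, add_right_comm]

end Operators

/-! ### The states of the chains -/

section States

variable {L V : Type*} {T : DForest L V} {S S' : Finset V} {root : V}

theorem DForest.exists_up_eq_none [Nonempty V] (F : DForest L V) : ∃ v, F.up v = none := by
  obtain ⟨m, -, hm⟩ := F.wf.has_min Set.univ Set.univ_nonempty
  refine ⟨m, ?_⟩
  rcases h : F.up m with _ | ⟨w, l⟩
  · rfl
  · exact absurd ⟨l, h⟩ (hm w trivial)

theorem belowEq_root (hroot : ∀ v, T.up v = none ↔ v = root) (v : V) : T.BelowEq v root := by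
  induction v using T.wf.induction with
  | _ v ih =>
    rcases h : T.up v with _ | ⟨w, l⟩
    · rw [(hroot v).1 h]
      exact DForest.BelowEq.refl _
    · exact Relation.ReflTransGen.tail (ih w ⟨l, h⟩) ⟨l, h⟩

/-- A path in `S` that starts at a vertex whose parent is missing never leaves the vertices below
its starting point, so it does not reach the root. -/
theorem IsRootedSubtree.parentClosed (hroot : ∀ v, T.up v = none ↔ v = root)
    (h : IsRootedSubtree T root S) : ParentClosed T S := by
  intro w v hwv hv
  by_contra hw
  have hbelow : ∀ b, (T.graph.induce (S : Set V)).Reachable ⟨v, hv⟩ b → T.BelowEq b.1 v := by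
    intro b hb
    rw [SimpleGraph.reachable_iff_reflTransGen] at hb
    induction hb with
    | refl => exact DForest.BelowEq.refl _
    | @tail a b _ hab ih =>
      rcases (hab : T.IsParent a.1 b.1 ∨ T.IsParent b.1 a.1) with hchild | hparent
      · exact Relation.ReflTransGen.tail ih hchild
      · have hav : a.1 ≠ v := fun hav =>
          hw (hwv.unique (show T.IsParent b.1 v from hav ▸ hparent) ▸ b.2)
        exact (ih.below_of_ne hav).belowEq_parent hparent
  have hroot_below : T.Below root w :=
    (hbelow ⟨root, h.1⟩ (h.2.preconnected _ _)).trans_below hwv.below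
  exact hroot_below.not_belowEq (belowEq_root hroot w)

theorem ParentClosed.isRootedSubtree (hroot : ∀ v, T.up v = none ↔ v = root)
    (hS : ParentClosed T S) (hne : S.Nonempty) : IsRootedSubtree T root S := by
  obtain ⟨v, hv⟩ := hne
  have hr : root ∈ S := hS.mem_of_belowEq (belowEq_root hroot v) hv
  have hreach : ∀ x (hx : x ∈ S),
      (T.graph.induce (S : Set V)).Reachable ⟨x, hx⟩ ⟨root, hr⟩ := by
    intro x
    induction x using T.wf.induction with
    | _ x ih =>
      intro hx
      rcases h : T.up x with _ | ⟨w, l⟩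
      · obtain rfl := (hroot x).1 h
        rfl
      · have hadj : (T.graph.induce (S : Set V)).Adj ⟨x, hx⟩ ⟨w, hS w x ⟨l, h⟩ hx⟩ :=
          Or.inr ⟨l, h⟩
        exact hadj.reachable.trans (ih w ⟨l, h⟩ _)
  have : Nonempty (S : Set V) := ⟨⟨root, hr⟩⟩
  exact ⟨hr, ⟨fun a b => (hreach a.1 a.2).trans (hreach b.1 b.2).symm⟩⟩

theorem isRootedSubtree_iff (hroot : ∀ v, T.up v = none ↔ v = root) :
    IsRootedSubtree T root S ↔ ParentClosed T S ∧ S.Nonempty :=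
  ⟨fun h => ⟨h.parentClosed hroot, root, h.1⟩, fun h => h.1.isRootedSubtree hroot h.2⟩

theorem isRootedSubtree_univ [Fintype V] (hroot : ∀ v, T.up v = none ↔ v = root) :
    IsRootedSubtree T root Finset.univ :=
  (isRootedSubtree_iff hroot).2 ⟨fun _ _ _ _ => Finset.mem_univ _, root, Finset.mem_univ _⟩

theorem ParentClosed.eq_root_of_restrict_up_eq_none (hroot : ∀ v, T.up v = none ↔ v = root)
    (hS : ParentClosed T S) {v : {v // v ∈ S}} (h : (T.restrict S).up v = none) : v.1 = root := by
  rcases hv : T.up v.1 with _ | ⟨w, l⟩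
  · exact (hroot _).1 hv
  · have hv' := (T.restrict_up_eq_some_iff (w := ⟨w, hS w v.1 ⟨l, hv⟩ v.2⟩)).2 hv
    simp [h] at hv'

theorem subset_of_iso_restrict (hroot : ∀ v, T.up v = none ↔ v = root)
    (hlab : ∀ v w a b l, T.up v = some (a, l) → T.up w = some (b, l) → v = w)
    (hS : ParentClosed T S) (hr : root ∈ S') (h : (T.restrict S).Iso (T.restrict S')) :
    S ⊆ S' := by
  obtain ⟨e, he⟩ := h
  intro v hv
  rcases hup : T.up v with _ | ⟨w, l⟩
  · rwa [(hroot v).1 hup]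
  · have hupS : (T.restrict S).up ⟨v, hv⟩ = some (⟨w, hS w v ⟨l, hup⟩ hv⟩, l) :=
      DForest.restrict_up_eq_some_iff.2 hup
    have hupS' := he ⟨v, hv⟩
    rw [hupS] at hupS'
    rw [hlab _ _ _ _ _ hup (DForest.restrict_up_eq_some_iff.1 hupS')]
    exact (e ⟨v, hv⟩).2

variable [Fintype V]

theorem initialState_eq_companyState_univ : initialState T = companyState T Finset.univ := by
  refine Subtype.ext ?_
  change T.toClass = bullet L ^ (Fintype.card V - Finset.univ.card) * _
  rw [Finset.card_univ, Nat.sub_self, pow_zero, one_mul, DForest.toClass_eq_iff]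
  exact T.iso_restrict_univ

theorem companyState_empty (v : V) : companyState T ∅ = companyState T {v} := by
  refine Subtype.ext ?_
  change bullet L ^ (Fintype.card V - (∅ : Finset V).card) * _ =
    bullet L ^ (Fintype.card V - ({v} : Finset V).card) * _
  rw [ForestClass.eq_one_of_degree_eq_zero (x := (T.restrict ∅).toClass)
      (by simp [ForestClass.degree_toClass]),
    ForestClass.eq_bullet_of_degree_eq_one (x := (T.restrict {v}).toClass)
      (by simp [ForestClass.degree_toClass]),
    ← pow_succ, mul_one, Finset.card_empty, Finset.card_singleton, Nat.sub_zero,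
    Nat.sub_add_cancel (Fintype.card_pos_iff.2 ⟨v⟩)]

theorem eta_companyState (S : Finset V) :
    eta (companyState T S).1 =
      (Fintype.card V).factorial / S.card.factorial * eta (T.restrict S).toClass := by
  have h := eta_bullet_pow_mul (Fintype.card V - S.card) (T.restrict S).toClass
  rw [ForestClass.degree_toClass, Fintype.card_coe, Nat.add_sub_of_le (Finset.card_le_univ S)] at h
  rw [div_mul_eq_mul_div, eq_div_iff (by positivity)]
  exact h

theorem eta_companyState_pos (T : DForest L V) (S : Finset V) : 0 < eta (companyState T S).1 := by
  have := eta_restrict_pos T S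
  rw [eta_companyState]
  positivity

theorem eta_companyState_erase_div {u : V} (hu : u ∈ S) :
    eta (companyState T (S.erase u)).1 / eta (companyState T S).1 =
      S.card * (eta (T.restrict (S.erase u)).toClass / eta (T.restrict S).toClass) := by
  have hpos := (eta_restrict_pos T S).ne'
  rw [eta_companyState, eta_companyState, ← Finset.card_erase_add_one hu, Nat.factorial_succ]
  push_cast
  field_simp

theorem basisVec_companyState (S : Finset V) :
    basisVec (companyState T S).1 =
      basisVec (bullet L) ^ (Fintype.card V - S.card) * basisVec (T.restrict S).toClass := by
  rw [← basisVec_pow, ← basisVec_mul]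
  rfl

/-- The indicator function of the structures whose state is `y`. -/
def stateIndicator (T : DForest L V) (y : Basis L (Fintype.card V)) (S : Finset V) : ℝ :=
  if companyState T S = y then 1 else 0

theorem stateIndicator_empty (y : Basis L (Fintype.card V)) (v : V) :
    stateIndicator T y ∅ = stateIndicator T y {v} := by
  rw [stateIndicator, stateIndicator, companyState_empty v]

/-- The Doob transform by `η` of `z ↦ •ᵏ ∂ᵏ z` removes `k` leaves, one after the other. -/
theorem eta_div_mul_coeff_iterate_leafDeletion (y : Basis L (Fintype.card V)) (k : ℕ)
    (S : Finset V) :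
    eta y.1 / eta (companyState T S).1 *
      (basisVec (bullet L) ^ (Fintype.card V - S.card + k) *
        (leafDeletion L)^[k] (basisVec (T.restrict S).toClass)).coeff y.1 =
      S.card.descFactorial k * (leafStep T)^[k] (stateIndicator T y) S := by
  induction k generalizing S with
  | zero =>
    rw [Function.iterate_zero_apply, Function.iterate_zero_apply, add_zero,
      ← basisVec_companyState, basisVec, MonoidAlgebra.coeff_single, Finsupp.single_apply,
      Nat.descFactorial_zero, Nat.cast_one, one_mul, stateIndicator]
    simp only [Subtype.coe_inj]
    split_ifs with h
    · rw [mul_one, ← h, div_self (eta_companyState_pos T S).ne']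
    · rw [mul_zero]
  | succ k ih =>
    rw [iterate_succ_leafDeletion_restrict, Finset.mul_sum, MonoidAlgebra.coeff_sum,
      Finsupp.finsetSum_apply, Finset.mul_sum, Function.iterate_succ_apply', leafStep,
      Finset.mul_sum]
    refine Finset.sum_congr rfl fun u hu => ?_
    have hcard := card_erase_add_one_of_mem_leaves hu
    have hle := Finset.card_le_univ S
    have hpos := (eta_companyState_pos T (S.erase u)).ne'
    rw [show Fintype.card V - S.card + (k + 1) = Fintype.card V - (S.erase u).card + k by omega]
    calc _ = eta (companyState T (S.erase u)).1 / eta (companyState T S).1 *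
          ((S.erase u).card.descFactorial k *
            (leafStep T)^[k] (stateIndicator T y) (S.erase u)) := by
          rw [← ih]
          field_simp
      _ = _ := by
          rw [eta_companyState_erase_div (mem_of_mem_leaves hu), ← hcard,
            Nat.succ_descFactorial_succ]
          push_cast
          ring

theorem drivenChain_T2R (S : Finset V) (y : Basis L (Fintype.card V)) :
    drivenChain (T2R L (Fintype.card V)) (companyState T S) y =
      (S.card : ℝ) / Fintype.card V * leafStep T (stateIndicator T y) S +
        ((Fintype.card V : ℝ) - S.card) / Fintype.card V * stateIndicator T y S := by
  have hstay := eta_div_mul_coeff_iterate_leafDeletion (T := T) y 0 S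
  have hfire := eta_div_mul_coeff_iterate_leafDeletion (T := T) y 1 S
  have hT2R := T2R_basisVec (companyState T S).1
  rw [(companyState T S).2, basisVec_companyState, bullet_mul_leafDeletion_bullet_pow_mul,
    Nat.cast_sub (Finset.card_le_univ S)] at hT2R
  simp only [Function.iterate_zero_apply, Function.iterate_one, Nat.descFactorial_zero,
    Nat.descFactorial_one, add_zero, Nat.cast_one, one_mul] at hstay hfire
  rw [drivenChain, Matrix.of_apply, basisVec_companyState, hT2R, ← hstay]
  simp only [MonoidAlgebra.coeff_smul, MonoidAlgebra.coeff_add, Finsupp.smul_apply,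
    Finsupp.add_apply, smul_eq_mul]
  linear_combination (1 / (Fintype.card V : ℝ)) * hfire

theorem drivenChain_BinT2R (q : ℝ) (S : Finset V) (y : Basis L (Fintype.card V)) :
    drivenChain (BinT2R L (Fintype.card V) q) (companyState T S) y =
      ∑ k ∈ Finset.range (S.card + 1), S.card.choose k * (1 - q) ^ k * q ^ (S.card - k) *
        (leafStep T)^[k] (stateIndicator T y) S := by
  have hdeg : (T.restrict S).toClass.degree = S.card := by
    rw [ForestClass.degree_toClass, Fintype.card_coe]
  have hBin := BinT2R_bullet_pow_mul (Fintype.card V - S.card) (T.restrict S).toClass q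
  rw [BinT2R_basisVec, hdeg, Nat.sub_add_cancel (Finset.card_le_univ S), basisVec_mul, basisVec_pow,
    ← basisVec_companyState] at hBin
  rw [drivenChain, Matrix.of_apply, hBin, Finset.mul_sum, MonoidAlgebra.coeff_sum,
    Finsupp.finsetSum_apply, Finset.mul_sum]
  refine Finset.sum_congr rfl fun k _ => ?_
  rw [mul_smul_comm, MonoidAlgebra.coeff_smul, Finsupp.smul_apply, ← mul_assoc (_ ^ _), ← pow_add,
    smul_eq_mul, mul_left_comm, eta_div_mul_coeff_iterate_leafDeletion,
    Nat.descFactorial_eq_factorial_mul_choose]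
  push_cast
  field_simp

/-! ### Recovering the tree from its state -/

theorem exists_ne_up_eq_none_of_toClass_eq {z : ForestClass L} (hz : 0 < z.degree)
    (h : T.toClass = bullet L * z) : ∃ a b, a ≠ b ∧ T.up a = none ∧ T.up b = none := by
  induction z using ForestClass.ind with | _ n G
  rw [ForestClass.degree_toClass, Fintype.card_fin] at hz
  have : Nonempty (Fin n) := ⟨⟨0, hz⟩⟩
  obtain ⟨v, hv⟩ := G.exists_up_eq_none
  rw [bullet, ForestClass.toClass_mul_toClass, DForest.toClass_eq_iff] at h
  obtain ⟨e, he⟩ := h.symm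
  refine ⟨e (Sum.inl 0), e (Sum.inr v), by simp, ?_, ?_⟩
  · rw [he]
    rfl
  · simp [he, DForest.sum, hv]

theorem toClass_eq_of_companyState_eq (hroot : ∀ v, T.up v = none ↔ v = root) (hne : S.Nonempty)
    (hS' : ParentClosed T S') (hle : S.card ≤ S'.card)
    (h : companyState T S = companyState T S') :
    (T.restrict S).toClass = (T.restrict S').toClass := by
  obtain ⟨d, hd⟩ := Nat.exists_eq_add_of_le hle
  have hle' := Finset.card_le_univ S'
  have hval : bullet L ^ (Fintype.card V - S.card) * (T.restrict S).toClass =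
      bullet L ^ (Fintype.card V - S'.card) * (T.restrict S').toClass := congrArg Subtype.val h
  rw [show Fintype.card V - S.card = Fintype.card V - S'.card + d by omega, pow_add,
    mul_assoc] at hval
  have hcancel : bullet L ^ d * (T.restrict S).toClass = (T.restrict S').toClass :=
    ForestClass.isLeftRegular_bullet.pow _ hval
  cases d with
  | zero => simpa using hcancel
  | succ d =>
    -- An isolated vertex besides `T[S]` would give `T[S']` two roots.
    rw [pow_succ', mul_assoc] at hcancel
    have hdegree : 0 < (bullet L ^ d * (T.restrict S).toClass).degree := by
      rw [ForestClass.degree_mul, ForestClass.degree_toClass, Fintype.card_coe]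
      exact Nat.add_pos_right _ (Finset.card_pos.2 hne)
    obtain ⟨a, b, hab, ha, hb⟩ := exists_ne_up_eq_none_of_toClass_eq hdegree hcancel.symm
    exact absurd (Subtype.ext ((hS'.eq_root_of_restrict_up_eq_none hroot ha).trans
      (hS'.eq_root_of_restrict_up_eq_none hroot hb).symm)) hab

theorem companyState_eq_iff (hroot : ∀ v, T.up v = none ↔ v = root)
    (hS : IsRootedSubtree T root S) (hS' : IsRootedSubtree T root S') :
    companyState T S = companyState T S' ↔
      (T.restrict S).toClass = (T.restrict S').toClass := by
  constructor
  · intro h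
    rcases le_total S.card S'.card with hle | hle
    · exact toClass_eq_of_companyState_eq hroot ⟨root, hS.1⟩ (hS'.parentClosed hroot) hle h
    · exact (toClass_eq_of_companyState_eq hroot ⟨root, hS'.1⟩ (hS.parentClosed hroot) hle
        h.symm).symm
  · intro h
    have hcard : S.card = S'.card := by
      simpa [ForestClass.degree_toClass] using congrArg ForestClass.degree h
    refine Subtype.ext ?_
    change bullet L ^ _ * _ = bullet L ^ _ * _
    rw [h, hcard]

theorem companyState_eq_iff_of_distinct_labels (hroot : ∀ v, T.up v = none ↔ v = root)
    (hlab : ∀ v w a b l, T.up v = some (a, l) → T.up w = some (b, l) → v = w)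
    (hS : IsRootedSubtree T root S) (hS' : IsRootedSubtree T root S') :
    companyState T S = companyState T S' ↔ S = S' := by
  refine ⟨fun h => ?_, fun h => h ▸ rfl⟩
  have hiso := DForest.toClass_eq_iff.1 ((companyState_eq_iff hroot hS hS').1 h)
  exact (subset_of_iso_restrict hroot hlab (hS.parentClosed hroot) hS'.1 hiso).antisymm
    (subset_of_iso_restrict hroot hlab (hS'.parentClosed hroot) hS.1 hiso.symm)

/-! ### The chains as images of the models -/

/-- The chain `K` on the forests is the image, under `S ↦ companyState T S`, of the restriction to
the rooted subtrees of the chain `M` on the sets of positions. -/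
structure IsImageChain (T : DForest L V) (root : V)
    (K : Matrix (Basis L (Fintype.card V)) (Basis L (Fintype.card V)) ℝ)
    (M : Matrix (Finset V) (Finset V) ℝ) : Prop where
  isRootedSubtree : ∀ S S', IsRootedSubtree T root S → M S S' ≠ 0 → IsRootedSubtree T root S'
  apply_companyState : ∀ S, IsRootedSubtree T root S → ∀ y,
    K (companyState T S) y = weightOfState T root (M S) y

theorem weightOfState_eq_sum_stateIndicator {μ : Finset V → ℝ}
    (hμ : ∀ S, μ S ≠ 0 → IsRootedSubtree T root S) (y : Basis L (Fintype.card V)) :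
    weightOfState T root μ y = ∑ S, μ S * stateIndicator T y S := by
  rw [weightOfState, Finset.sum_filter]
  refine Finset.sum_congr rfl fun S _ => ?_
  by_cases hS : μ S = 0
  · simp [hS]
  · simp [stateIndicator, hμ S hS]

theorem isImageChain_singleModel (hroot : ∀ v, T.up v = none ↔ v = root) :
    IsImageChain T root (drivenChain (T2R L (Fintype.card V))) (singleModel T) := by
  have hstay : ∀ S S', IsRootedSubtree T root S → singleModel T S S' ≠ 0 →
      IsRootedSubtree T root S' := fun S S' hS h =>
    (isRootedSubtree_iff hroot).2
      (parentClosed_of_singleModel_ne_zero (hS.parentClosed hroot) ⟨root, hS.1⟩ h)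
  refine ⟨hstay, fun S hS y => ?_⟩
  rw [weightOfState_eq_sum_stateIndicator fun S' => hstay S S' hS, drivenChain_T2R,
    sum_singleModel_mul (hS.parentClosed hroot) ⟨root, hS.1⟩ _ (stateIndicator_empty y)]

theorem isImageChain_binomialModel (hroot : ∀ v, T.up v = none ↔ v = root) {q : ℝ} (hq₀ : 0 ≤ q)
    (hq₁ : q ≤ 1) :
    IsImageChain T root (drivenChain (BinT2R L (Fintype.card V) q)) (binomialModel T q) := by
  have hstay : ∀ S S', IsRootedSubtree T root S → binomialModel T q S S' ≠ 0 →
      IsRootedSubtree T root S' := fun S S' hS h =>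
    (isRootedSubtree_iff hroot).2
      (parentClosed_of_binomialModel_ne_zero (hS.parentClosed hroot) ⟨root, hS.1⟩ h)
  refine ⟨hstay, fun S hS y => ?_⟩
  rw [weightOfState_eq_sum_stateIndicator fun S' => hstay S S' hS, drivenChain_BinT2R,
    sum_binomialModel_mul hq₀ hq₁ (hS.parentClosed hroot) ⟨root, hS.1⟩ _ (stateIndicator_empty y)]

namespace IsImageChain

variable {K : Matrix (Basis L (Fintype.card V)) (Basis L (Fintype.card V)) ℝ}
  {M : Matrix (Finset V) (Finset V) ℝ}

theorem exists_eq_companyState_of_pow_ne_zero [Finite L] (h : IsImageChain T root K M)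
    (hS : IsRootedSubtree T root S) (t : ℕ) (y : Basis L (Fintype.card V))
    (hy : (K ^ t) (companyState T S) y ≠ 0) :
    ∃ S', IsRootedSubtree T root S' ∧ y = companyState T S' := by
  induction t generalizing y with
  | zero =>
    rw [pow_zero] at hy
    refine ⟨S, hS, ?_⟩
    by_contra hne
    exact hy (Matrix.one_apply_ne (Ne.symm hne))
  | succ t ih =>
    rw [pow_succ, Matrix.mul_apply] at hy
    obtain ⟨z, -, hz⟩ := Finset.exists_ne_zero_of_sum_ne_zero hy
    obtain ⟨S', hS', rfl⟩ := ih z (left_ne_zero_of_mul hz)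
    have hweight := right_ne_zero_of_mul hz
    rw [h.apply_companyState S' hS', weightOfState] at hweight
    obtain ⟨S'', hS'', -⟩ := Finset.exists_ne_zero_of_sum_ne_zero hweight
    obtain ⟨-, hsub, hy⟩ := Finset.mem_filter.1 hS''
    exact ⟨S'', hsub, hy.symm⟩

theorem apply_companyState_companyState (h : IsImageChain T root K M)
    (hinj : ∀ S S', IsRootedSubtree T root S → IsRootedSubtree T root S' →
      (companyState T S = companyState T S' ↔ S = S'))
    (hS : IsRootedSubtree T root S) (hS' : IsRootedSubtree T root S') :
    K (companyState T S) (companyState T S') = M S S' := by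
  rw [h.apply_companyState S hS, weightOfState, Finset.sum_eq_single S']
  · intro A hA hne
    obtain ⟨-, hsub, hstate⟩ := Finset.mem_filter.1 hA
    exact absurd ((hinj A S' hsub hS').1 hstate) hne
  · exact fun hnot => absurd (Finset.mem_filter.2 ⟨Finset.mem_univ _, hS', rfl⟩) hnot

end IsImageChain

end States

end CKTree

end


open CKTree in
theorem theorem5p2 {L V : Type*} [Finite L] [Fintype V] (T₀ : DForest L V) (root : V)
    (hroot : ∀ v, T₀.up v = none ↔ v = root) (q : ℝ) (hq₀ : 0 ≤ q) (hq₁ : q ≤ 1) :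
    -- the starting state is that of the whole company
    (IsRootedSubtree T₀ root Finset.univ ∧ initialState T₀ = companyState T₀ Finset.univ) ∧
    -- `•^(n₀ - n) ⨿ T ↦ T` is well defined and injective
    (∀ S S', IsRootedSubtree T₀ root S → IsRootedSubtree T₀ root S' →
      (companyState T₀ S = companyState T₀ S' ↔
        (T₀.restrict S).toClass = (T₀.restrict S').toClass)) ∧
    -- the two chains and the corresponding models
    (∀ (K : Matrix (Basis L (Fintype.card V)) (Basis L (Fintype.card V)) ℝ)
        (M : Matrix (Finset V) (Finset V) ℝ),
      (K = drivenChain (T2R L (Fintype.card V)) ∧ M = singleModel T₀) ∨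
        (K = drivenChain (BinT2R L (Fintype.card V) q) ∧ M = binomialModel T₀ q) →
      (∀ (t : ℕ) (y : Basis L (Fintype.card V)), (K ^ t) (initialState T₀) y ≠ 0 →
        ∃ S, IsRootedSubtree T₀ root S ∧ y = companyState T₀ S) ∧
      (∀ S S', IsRootedSubtree T₀ root S → M S S' ≠ 0 → IsRootedSubtree T₀ root S') ∧
      (∀ S, IsRootedSubtree T₀ root S → ∀ y,
        K (companyState T₀ S) y = weightOfState T₀ root (M S) y) ∧
      -- when the positions have distinct labels, states are literally vertex sets
      ((∀ v w a b l, T₀.up v = some (a, l) → T₀.up w = some (b, l) → v = w) →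
        ∀ S S', IsRootedSubtree T₀ root S → IsRootedSubtree T₀ root S' →
          (companyState T₀ S = companyState T₀ S' ↔ S = S') ∧
          K (companyState T₀ S) (companyState T₀ S') = M S S')) ∧
    -- in the single model, the fired employee may also be chosen among the non-boss employees
    (∀ S C S', IsRootedSubtree T₀ root S → 2 ≤ S.card → (∀ e, e ∈ C ↔ e ∈ S ∧ e ≠ root) →
      uniformFiring T₀ S S S' = uniformFiring T₀ C S S') := by
  classical
  refine ⟨⟨isRootedSubtree_univ hroot, initialState_eq_companyState_univ⟩,
    fun S S' => companyState_eq_iff hroot, ?_, ?_⟩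
  · intro K M hKM
    have hK : IsImageChain T₀ root K M := by
      rcases hKM with ⟨rfl, rfl⟩ | ⟨rfl, rfl⟩
      · exact isImageChain_singleModel hroot
      · exact isImageChain_binomialModel hroot hq₀ hq₁
    refine ⟨fun t y hy => ?_, hK.isRootedSubtree, hK.apply_companyState,
      fun hlab S S' hS hS' => ?_⟩
    · rw [initialState_eq_companyState_univ] at hy
      exact hK.exists_eq_companyState_of_pow_ne_zero (isRootedSubtree_univ hroot) t y hy
    · have hinj := fun S S' => companyState_eq_iff_of_distinct_labels (S := S) (S' := S') hroot hlab
      exact ⟨hinj S S' hS hS', hK.apply_companyState_companyState hinj hS hS'⟩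
  · intro S C S' hS hcard hC
    obtain rfl : C = S.erase root := by
      ext e
      rw [hC, Finset.mem_erase, and_comm]
    exact uniformFiring_erase_root (hS.parentClosed hroot) hcard hS.1
      (fun v _ => belowEq_root hroot v) S'
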